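/- For $n\ge 1$ let $n^\omega$ be the space of infinite sequences over the alphabet $\{0,\dots,n-1\}$, $n^{<\omega}$ the set of finite strings over it, and $\lambda$ the uniform (Lebesgue) product measure on $n^\omega$. A sequence $x\in n^\omega$ is *random* (Martin-Löf random for $\lambda$) if $x\notin\bigcap_i U_i$ for every uniformly $\Sigma^0_1$ sequence $(U_i)_{i\in\omega}$ of subsets of $n^\omega$ with $\lambda(U_i)\le 2^{-i}$ for all $i$. Let $\sigma_0=\epsilon,\sigma_1=0,\sigma_2=1,\sigma_3=00,\dots$ be the length-lexicographic enumeration of $2^{<\omega}$. *Random closed sets.* For $x\in 3^\omega$ let $T_x\subseteq 2^{<\omega}$ be the tree such that $\epsilon\in T_x$ and, whenever $\sigma$ is the $(i+1)$-st element of $T_x$ in the length-lexicographic order, the children of $\sigma$ in $T_x$ are: only $\sigma0$ if $x(i)=0$; only $\sigma1$ if $x(i)=1$; both $\sigma0$ and $\sigma1$ if $x(i)=2$. Let $[T_x]\subseteq 2^\omega$ be its set of infinite paths. A non-empty closed set $C\subseteq 2^\omega$ is a *random closed set* if $C=[T_x]$ for some random $x\in 3^\omega$. *Random continuous functions.* For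 $x\in 3^\omega$ label each non-empty string by $\ell_x(\sigma_i)=x(i-1)$, $i\ge 1$, and let $F_x$ be the partial function from $2^\omega$ to $2^\omega$ for which $F_x(y)$ is the result of removing all $2$'s from the sequence $\ell_x(y\restriction 1),\ell_x(y\restriction 2),\ell_x(y\restriction 3),\dots$ ($F_x(y)$ is undefined if only finitely many $0$'s and $1$'s remain). A partial function $F$ from $2^\omega$ to $2^\omega$, continuous on its domain, is a *random continuous function* if $F=F_x$ for some random $x\in 3^\omega$. Its zero set is $Z_F=\{y\in 2^\omega : F(y)\text{ is defined and } F(y)=0^\omega\}$. **Theorem.** (i) For every random continuous function $F$, if $Z_F\neq\emptyset$ then $Z_F$ is a random closed set. (ii) For every random closed set $C\subseteq 2^\omega$ there is a random continuous function $F$ such that $C=Z_F$. -/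

import Mathlib

open MeasureTheory
open scoped ENNReal

namespace RandomZeros

/-- The space `n^ω` of infinite sequences over the alphabet `{0, …, n-1}`, with the product
topology and the product (Borel) σ-algebra. -/
abbrev Seq (n : ℕ) : Type := ℕ → Fin n

/-- The initial segment `x ↾ k` of length `k`. -/
def prefixOf {n : ℕ} (x : Seq n) (k : ℕ) : List (Fin n) := List.ofFn fun i : Fin k => x i

/-- The basic clopen set of all infinite sequences extending the finite string `σ`. -/
def cylinder {n : ℕ} (σ : List (Fin n)) : Set (Seq n) := {x | prefixOf x σ.length = σ}

/-- The Lebesgue measure on `n^ω`: the product of the uniform measures on `{0, …, n-1}`. -/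
noncomputable def lebesgue (n : ℕ) [NeZero n] : Measure (Seq n) :=
  Measure.infinitePi fun _ : ℕ => (PMF.uniformOfFintype (Fin n)).toMeasure

/-- The `i`-th open set generated by a set `W` of pairs (index, finite string). The uniformly
`Σ⁰₁` sequences of classes are exactly the sequences `openFamily W` with `W` recursively
enumerable. -/
def openFamily {n : ℕ} (W : ℕ × List (Fin n) → Prop) (i : ℕ) : Set (Seq n) :=
  {x | ∃ σ, W (i, σ) ∧ x ∈ cylinder σ}

/-- `W` enumerates a `μ`-Martin-Löf test. -/
def IsMLTest {n : ℕ} (μ : Measure (Seq n)) (W : ℕ × List (Fin n) → Prop) : Prop :=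
  REPred W ∧ ∀ i, μ (openFamily W i) ≤ (2 : ℝ≥0∞)⁻¹ ^ i

/-- The set of `μ`-Martin-Löf random sequences. -/
def MLR {n : ℕ} (μ : Measure (Seq n)) : Set (Seq n) :=
  {x | ∀ W, IsMLTest μ W → x ∉ ⋂ i, openFamily W i}

/-- The position of a binary string in the length-lexicographic enumeration
`σ₀ = ε, σ₁ = 0, σ₂ = 1, σ₃ = 00, …` of `2^{<ω}`; the children of `σ_p` are `σ_{2p+1}`
(append `0`) and `σ_{2p+2}` (append `1`). -/
def strIndex (σ : List (Fin 2)) : ℕ := σ.foldl (fun (p : ℕ) (b : Fin 2) => 2 * p + 1 + (b : ℕ)) 0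

/-- Whether the string `σ_k` belongs to the tree `T_x` coded by `x ∈ 3^ω`. The root does. For
`k = n + 1`, the parent of `σ_k` is `σ_p` with `p = n / 2`, and the last bit of `σ_k` is `n % 2`.
If `σ_p` belongs to the tree and `i` nodes of the tree precede it in the length-lexicographic
order, then the children of `σ_p` in the tree are: only the `0`-child if `x i = 0`, only the
`1`-child if `x i = 1`, both if `x i = 2`. (All nodes of the tree are extendible.) -/
def nodeInTree (x : Seq 3) : ℕ → Bool
  | 0 => true
  | n + 1 =>
    let i := (List.finRange (n / 2)).countP fun m : Fin (n / 2) => nodeInTree x m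
    nodeInTree x (n / 2) && decide ((x i : ℕ) = n % 2 ∨ x i = 2)
  decreasing_by all_goals omega

/-- The tree `T_x ⊆ 2^{<ω}` without dead ends coded by `x ∈ 3^ω`. -/
def codedTree (x : Seq 3) : Set (List (Fin 2)) := {σ | nodeInTree x (strIndex σ) = true}

/-- The set `[T]` of infinite paths through `T`. -/
def paths (T : Set (List (Fin 2))) : Set (Seq 2) := {y | ∀ k, prefixOf y k ∈ T}

/-- Random closed sets. -/
def IsRandomClosedSet (C : Set (Seq 2)) : Prop :=
  C.Nonempty ∧ IsClosed C ∧ ∃ x ∈ MLR (lebesgue 3), C = paths (codedTree x)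

/-- The labeling `ℓ_x` of the non-empty binary strings: `ℓ_x(σ_i) = x (i - 1)` for `i ≥ 1`. -/
def label (x : Seq 3) (σ : List (Fin 2)) : Fin 3 := x (strIndex σ - 1)

/-- The result of removing all `2`s from a sequence `a ∈ 3^ω`; it is defined if and only if
infinitely many `0`s and `1`s remain. -/
noncomputable def removeTwos (a : Seq 3) : Part (Seq 2) where
  Dom := {k | a k ≠ 2}.Infinite
  get h := fun j => (a (Nat.nth (fun k => a k ≠ 2) j)).castLT (by
    have := Nat.nth_mem_of_infinite (p := fun k => a k ≠ 2) h j
    omega)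

/-- The partial function `F_x` on `2^ω` coded by `x ∈ 3^ω`: remove the `2`s from the sequence
`ℓ_x(y ↾ 1), ℓ_x(y ↾ 2), …`. -/
noncomputable def codedFun (x : Seq 3) : Seq 2 →. Seq 2 :=
  fun y => removeTwos fun k => label x (prefixOf y (k + 1))

/-- A partial function is continuous on its domain (with the subspace topology). -/
def IsContinuousPartial (F : Seq 2 →. Seq 2) : Prop :=
  Continuous fun y : F.Dom => F.fn y.1 y.2

/-- Random (partial) continuous functions on `2^ω`. -/
def IsRandomContinuous (F : Seq 2 →. Seq 2) : Prop :=
  IsContinuousPartial F ∧ ∃ x ∈ MLR (lebesgue 3), F = codedFun x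

/-- The set `Z_F` of all `y` such that `F y` is defined and equal to `0^ω`. -/
def zeroSet (F : Seq 2 →. Seq 2) : Set (Seq 2) := {y | (fun _ => 0) ∈ F y}

end RandomZeros

namespace RandomZeros

/-! ### Prefixes and nodes of the binary tree -/

/-! If no branch is eventually labelled `2`, the zero set of `codedFun x` is the set `survivors x`
of branches without a label `1` (`zeroSet_codedFun`). Under uniform labels the nodes reached without
a `1` form a branching process. The probability `p` that a branch survives below a given node
satisfies `1 - p = (1 - 2 * p / 3) ^ 2`, so `p = 3 / 4`. Given survival, each child is reached and
extendible with weight `2 / 3 * 3 / 4 = 1 / 2`. Hence the cases "left only", "right only" and "both"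
have probability `1 / 3` each: the surviving tree has exactly the law of `codedTree z` for uniform
`z`.

`couple` runs this in reverse. From `z`, which prescribes the tree of extendible nodes, and
auxiliary symbols `r`, it draws each label from its conditional law. The flag `c` says whether there
is a tree at all. With `c` true of weight `3 / 4` the resulting labeling is uniform
(`lebesgue_eq_couple`). The survivors are the prescribed ones unless some branch has a tail of
exceptional symbols of `r`. Such tails, like tails of `2`s in `x`, are covered by the explicit test
`chain`: `2 ^ s` chains of length `s`, each of probability at most `3⁻¹ ^ s`.

For (i), suppose that a test captures the code `z` of the surviving tree of `x`. The labelings all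
of whose `couple`-preimages have `c` true and `z` in the test, or `r` in `chain`, form an
effectively open set by compactness. Its measure is small by the law of the coupling, so `x` would
not be random (`exists_random_code`).

For (ii), given a random `z` and a test on labelings, the trees over which the test has a large
fibre form a test by Markov's inequality. So almost every `r` makes `couple true z r` pass the given
test, and since there are countably many tests, some `r` works for all of them and has no
exceptional tail (`exists_random_labeling`). -/

theorem prefixOf_eq_iff {n : ℕ} {x y : Seq n} {k : ℕ} :
    prefixOf x k = prefixOf y k ↔ ∀ i < k, x i = y i := by
  unfold prefixOf
  rw [List.ofFn_inj]
  exact ⟨fun h i hi => congrFun h ⟨i, hi⟩, fun h => funext fun i => h i i.2⟩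

@[simp] theorem length_prefixOf {n : ℕ} (x : Seq n) (k : ℕ) : (prefixOf x k).length = k := by
  simp [prefixOf]

theorem mem_openFamily {n : ℕ} {W : ℕ × List (Fin n) → Prop} {i : ℕ} {x : Seq n} :
    x ∈ openFamily W i ↔ ∃ m, W (i, prefixOf x m) := by
  constructor
  · rintro ⟨σ, hσ, hx⟩
    exact ⟨σ.length, by rw [show prefixOf x σ.length = σ from hx]; exact hσ⟩
  · rintro ⟨m, hm⟩
    exact ⟨_, hm, by simp [cylinder]⟩

/-- The `k`-th node on the branch that starts at the node with index `p` and follows the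
directions `b`. -/
def descend (p : ℕ) (b : Seq 2) : ℕ → ℕ
  | 0 => p
  | k + 1 => 2 * descend p b k + 1 + b k

theorem strIndex_prefixOf (y : Seq 2) (k : ℕ) : strIndex (prefixOf y k) = descend 0 y k := by
  induction k with
  | zero => simp [prefixOf, strIndex, descend]
  | succ k ih =>
    have : prefixOf y (k + 1) = prefixOf y k ++ [y k] := by
      simp only [prefixOf, List.ofFn_succ_last]
      simp
    rw [this]
    unfold strIndex at ih ⊢
    rw [List.foldl_append, ih]
    simp [descend]

theorem descend_succ_sub_one (p : ℕ) (b : Seq 2) (k : ℕ) :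
    descend p b (k + 1) - 1 = 2 * descend p b k + b k := by
  simp only [descend]; omega

theorem descend_succ_div (p : ℕ) (b : Seq 2) (k : ℕ) :
    (2 * descend p b k + (b k : ℕ)) / 2 = descend p b k := by
  have := (b k).2; omega

/-- The binary expansion of an index plus one is a `1` followed by the bits of the node, so dividing
by `2 ^ j` climbs `j` levels. The test `chain` addresses ancestors in this way. -/
theorem descend_add_one_div (b : Seq 2) (p k j : ℕ) :
    (descend p b (k + j) + 1) / 2 ^ j = descend p b k + 1 := by
  induction j with
  | zero => simp
  | succ j ih =>
    rw [pow_succ', ← Nat.div_div_eq_div_mul, ← ih]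
    congr 1
    rw [show k + (j + 1) = (k + j) + 1 by omega]
    simp only [descend]
    have := (b (k + j)).2; omega

theorem descend_cons (p : ℕ) (a : Fin 2) (b : Seq 2) (k : ℕ) :
    descend p (fun i => Nat.casesOn i a b) (k + 1) = descend (2 * p + 1 + a) b k := by
  induction k with
  | zero => simp [descend]
  | succ k ih => rw [descend, ih]; rfl

/-- A branch from an arbitrary node inside a parent-closed set extends to a branch from the root. -/
theorem exists_branch_of_descend {Q : ℕ → Prop} (hQ : ∀ n, Q (n + 1) → Q (n / 2)) (n : ℕ)
    (b : Seq 2) (hb : ∀ k, Q (descend n b k)) :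
    ∃ (y : Seq 2) (k : ℕ), (∀ j, descend 0 y (k + j) = descend n b j) ∧
      ∀ j, Q (descend 0 y j) := by
  induction n using Nat.strong_induction_on generalizing b with
  | _ n ih =>
    rcases n with _ | m
    · exact ⟨b, 0, by simp, hb⟩
    · let a : Fin 2 := ⟨m % 2, by omega⟩
      have hm : 2 * (m / 2) + 1 + a = m + 1 := by simp only [a]; omega
      have hcons (k : ℕ) : descend (m / 2) (fun i => Nat.casesOn i a b) (k + 1)
          = descend (m + 1) b k := by rw [descend_cons, hm]
      obtain ⟨y, k, hk, hy⟩ := ih (m / 2) (by omega) (fun i => Nat.casesOn i a b) (by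
        rintro (_ | k)
        · exact hQ m (hb 0)
        · rw [hcons]; exact hb k)
      exact ⟨y, k + 1, fun j => by rw [← hcons, ← hk]; congr 1; omega, hy⟩

theorem exists_branch_through {Q : ℕ → Prop} (hQ : ∀ n, Q (n + 1) → Q (n / 2))
    (hQ' : ∀ n, Q n → Q (2 * n + 1) ∨ Q (2 * n + 2)) {n : ℕ} (hn : Q n) :
    ∃ (y : Seq 2) (k : ℕ), descend 0 y k = n ∧ ∀ j, Q (descend 0 y j) := by
  classical
  -- Below `n`, go to the left child whenever it lies in `Q`, and to the right child otherwise.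
  let f : ℕ → ℕ := fun k => Nat.rec n
    (fun _ m => if Q (2 * m + 1) then 2 * m + 1 else 2 * m + 2) k
  let b : Seq 2 := fun k => if Q (2 * f k + 1) then 0 else 1
  have hf (k : ℕ) : descend n b k = f k := by
    induction k with
    | zero => rfl
    | succ k ih =>
      have : f (k + 1) = if Q (2 * f k + 1) then 2 * f k + 1 else 2 * f k + 2 := rfl
      rw [descend, ih, this]
      by_cases h : Q (2 * f k + 1) <;> simp [b, h]
  suffices h : ∀ k, Q (descend n b k) by
    obtain ⟨y, k, hk, hy⟩ := exists_branch_of_descend hQ n b h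
    exact ⟨y, k, hk 0, hy⟩
  intro k
  induction k with
  | zero => exact hn
  | succ k ih =>
    rw [hf] at ih ⊢
    have : f (k + 1) = if Q (2 * f k + 1) then 2 * f k + 1 else 2 * f k + 2 := rfl
    rw [this]
    split_ifs with h
    · exact h
    · exact (hQ' _ ih).resolve_left h

/-! ### The coded tree -/

/-- The number of nodes of the tree coded by `z` that precede the node with index `n`. -/
def rank (z : Seq 3) (n : ℕ) : ℕ := Nat.count (fun m => nodeInTree z m = true) n

@[simp] theorem nodeInTree_zero (z : Seq 3) : nodeInTree z 0 = true := by
  rw [nodeInTree]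

theorem countP_finRange (f : ℕ → Bool) (m : ℕ) :
    (List.finRange m).countP (fun i : Fin m => f i) = (List.range m).countP f := by
  rw [← List.map_coe_finRange_eq_range, List.countP_map]; rfl

theorem nodeInTree_succ (z : Seq 3) (n : ℕ) :
    nodeInTree z (n + 1) = (nodeInTree z (n / 2) &&
      decide ((z (rank z (n / 2)) : ℕ) = n % 2 ∨ z (rank z (n / 2)) = 2)) := by
  rw [nodeInTree]
  have : (List.finRange (n / 2)).countP (fun m : Fin (n / 2) => nodeInTree z m)
      = rank z (n / 2) := by
    rw [countP_finRange, rank, Nat.count]; simp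
  simp only [this]

theorem rank_le (z : Seq 3) (n : ℕ) : rank z n ≤ n := Nat.count_le _

theorem rank_succ (z : Seq 3) (n : ℕ) :
    rank z (n + 1) = rank z n + if nodeInTree z n then 1 else 0 := by
  simp [rank, Nat.count_succ]

theorem rank_mono (z : Seq 3) : Monotone (rank z) := Nat.count_monotone _

theorem nodeInTree_left (z : Seq 3) (n : ℕ) :
    nodeInTree z (2 * n + 1) = (nodeInTree z n && decide (z (rank z n) ≠ 1)) := by
  rw [nodeInTree_succ, show 2 * n / 2 = n by omega, show 2 * n % 2 = 0 by omega]
  congr 1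
  generalize z (rank z n) = a
  revert a; decide

theorem nodeInTree_right (z : Seq 3) (n : ℕ) :
    nodeInTree z (2 * n + 2) = (nodeInTree z n && decide (z (rank z n) ≠ 0)) := by
  rw [show 2 * n + 2 = (2 * n + 1) + 1 by omega, nodeInTree_succ,
    show (2 * n + 1) / 2 = n by omega, show (2 * n + 1) % 2 = 1 by omega]
  congr 1
  generalize z (rank z n) = a
  revert a; decide

/-- The tree up to the node `n` depends only on the symbols read before the node `n / 2 + 1`,
if these are the first `k` symbols. -/
theorem nodeInTree_congr {z z' : Seq 3} {n k : ℕ} (hk : ∀ m, 2 * m < n → rank z m < k ∨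
    nodeInTree z m = false) (h : ∀ i < k, z i = z' i) :
    ∀ m ≤ n, nodeInTree z m = nodeInTree z' m := by
  intro m
  induction m using Nat.strong_induction_on with
  | _ m ih =>
    intro hm
    rcases m with _ | m
    · simp
    · have hr : rank z (m / 2) = rank z' (m / 2) := by
        unfold rank
        rw [Nat.count, Nat.count]
        apply List.countP_congr
        intro j hj
        have hj := List.mem_range.1 hj
        simp [ih j (by omega) (by omega)]
      rw [nodeInTree_succ, nodeInTree_succ, ← hr, ih (m / 2) (by omega) (by omega)]
      rcases hk (m / 2) (by omega) with h1 | h1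
      · rw [h _ h1]
      · rw [← ih (m / 2) (by omega) (by omega), h1]; simp

theorem nodeInTree_congr_of_lt {z z' : Seq 3} {n : ℕ} (h : ∀ i < n, z i = z' i) :
    ∀ m ≤ n, nodeInTree z m = nodeInTree z' m :=
  nodeInTree_congr (k := n) (fun m hm => .inl ((rank_le z m).trans_lt (by omega))) h

theorem mem_paths_codedTree {z : Seq 3} {y : Seq 2} :
    y ∈ paths (codedTree z) ↔ ∀ k, nodeInTree z (descend 0 y k) = true := by
  simp [paths, codedTree, strIndex_prefixOf]

theorem isClosed_paths (T : Set (List (Fin 2))) : IsClosed (paths T) := by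
  have : paths T = ⋂ k, {y | prefixOf y k ∈ T} := by ext; simp [paths]
  rw [this]
  refine isClosed_iInter fun k => ?_
  have hc : Continuous (fun y : Seq 2 => fun i : Fin k => y i) := by fun_prop
  exact (isClosed_discrete {f : Fin k → Fin 2 | List.ofFn f ∈ T}).preimage hc

theorem nodeInTree_parent {z : Seq 3} {n : ℕ} (h : nodeInTree z (n + 1) = true) :
    nodeInTree z (n / 2) = true := by
  rw [nodeInTree_succ] at h; simp_all

theorem nodeInTree_child {z : Seq 3} {n : ℕ} (h : nodeInTree z n = true) :
    nodeInTree z (2 * n + 1) = true ∨ nodeInTree z (2 * n + 2) = true := by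
  rw [nodeInTree_left, nodeInTree_right, h]
  generalize z (rank z n) = a
  revert a; decide

/-- The set of nodes of the tree is infinite, so that each symbol of the code is read. -/
theorem exists_rank_eq (z : Seq 3) (i : ℕ) : ∃ n, nodeInTree z n = true ∧ rank z n = i := by
  have hinf : {n | nodeInTree z n = true}.Infinite := by
    rw [Set.infinite_iff_exists_gt]
    intro a
    obtain ⟨y, k, -, hy⟩ := exists_branch_through (Q := fun n => nodeInTree z n = true)
      (fun n => nodeInTree_parent) (fun n => nodeInTree_child) (nodeInTree_zero z)
    refine ⟨_, hy (a + 1), ?_⟩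
    suffices ∀ k, k ≤ descend 0 y k from Nat.lt_of_succ_le (this (a + 1))
    intro k
    induction k with
    | zero => simp
    | succ k ih => simp only [descend]; omega
  exact ⟨_, Nat.nth_mem_of_infinite hinf i, Nat.count_nth_of_infinite hinf i⟩

/-- Every symbol of the code is read at some node, and the children of that node reveal which symbol
it is. -/
theorem nodeInTree_injective {z z' : Seq 3} (h : ∀ n, nodeInTree z n = nodeInTree z' n) :
    z = z' := by
  funext i
  obtain ⟨n, hn, hi⟩ := exists_rank_eq z i
  have hr : rank z n = rank z' n := by unfold rank; simp [h]
  have h1 := h (2 * n + 1)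
  have h2 := h (2 * n + 2)
  rw [nodeInTree_left, nodeInTree_left, ← h n, hn, ← hr, hi] at h1
  rw [nodeInTree_right, nodeInTree_right, ← h n, hn, ← hr, hi] at h2
  revert h1 h2
  generalize z i = a
  generalize z' i = b
  revert a b; decide

/-- Every nonempty parent-closed set of nodes without dead ends is coded by a sequence. -/
theorem exists_code {Q : ℕ → Prop} (h0 : Q 0) (hQ : ∀ n, Q (n + 1) → Q (n / 2))
    (hQ' : ∀ n, Q n → Q (2 * n + 1) ∨ Q (2 * n + 2)) :
    ∃ z : Seq 3, ∀ n, nodeInTree z n = true ↔ Q n := by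
  classical
  -- The `i`-th symbol describes the children of the `i`-th element of `Q`.
  let z : Seq 3 := fun i => if ¬ Q (2 * Nat.nth Q i + 1) then 1 else
    if ¬ Q (2 * Nat.nth Q i + 2) then 0 else 2
  refine ⟨z, fun n => ?_⟩
  induction n using Nat.strong_induction_on with
  | _ n ih =>
    rcases n with _ | n
    · simp [h0]
    · have hr : rank z (n / 2) = Nat.count Q (n / 2) := by
        unfold rank
        rw [Nat.count, Nat.count]
        apply List.countP_congr
        intro j hj
        have hj := List.mem_range.1 hj
        simp [ih j (by omega)]
      rw [nodeInTree_succ, hr, Bool.and_eq_true, ih (n / 2) (by omega)]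
      constructor
      · rintro ⟨h1, h2⟩
        simp only [z, Nat.nth_count h1] at h2
        have h3 := hQ' _ h1
        rcases Nat.mod_two_eq_zero_or_one n with hn | hn
        · have e : 2 * (n / 2) + 1 = n + 1 := by omega
          rw [e] at h2
          by_contra hc
          simp [hc, hn] at h2
        · have e : 2 * (n / 2) + 2 = n + 1 := by omega
          rw [e] at h2 h3
          by_contra hc
          have h4 := h3.resolve_right hc
          simp [hc, hn, h4] at h2
      · intro h
        have h1 := hQ n h
        refine ⟨h1, ?_⟩
        simp only [z, Nat.nth_count h1]
        rcases Nat.mod_two_eq_zero_or_one n with hn | hn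
        · have e : 2 * (n / 2) + 1 = n + 1 := by omega
          rw [e]
          simp only [h, hn]
          split_ifs <;> simp_all
        · have e : 2 * (n / 2) + 2 = n + 1 := by omega
          rw [e]
          simp only [h, hn]
          split_ifs <;> simp_all

/-! ### Nodes cut off by a label `1` -/

/-- Whether a label `1` occurs on the way to the node with index `n`. -/
def killed (x : Seq 3) : ℕ → Bool
  | 0 => false
  | n + 1 => killed x (n / 2) || decide (x n = 1)
  decreasing_by omega

/-- The branches that avoid the label `1`. -/
def survivors (x : Seq 3) : Set (Seq 2) := {y | ∀ k, killed x (descend 0 y k) = false}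

/-- Almost all nodes of some branch have a label in the set `S`. -/
def HasTail {n : ℕ} (S : Fin n → Bool) (x : Seq n) : Prop :=
  ∃ (y : Seq 2) (N : ℕ), ∀ k ≥ N, S (x (2 * descend 0 y k + y k)) = true

theorem killed_descend (x : Seq 3) (y : Seq 2) (k : ℕ) :
    killed x (descend 0 y (k + 1)) =
      (killed x (descend 0 y k) || decide (x (2 * descend 0 y k + y k) = 1)) := by
  rw [show descend 0 y (k + 1) = (2 * descend 0 y k + y k) + 1 by simp only [descend]; omega,
    killed, descend_succ_div]

theorem mem_survivors {x : Seq 3} {y : Seq 2} :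
    y ∈ survivors x ↔ ∀ k, x (2 * descend 0 y k + y k) ≠ 1 := by
  constructor
  · intro h k
    have := h (k + 1)
    rw [killed_descend] at this
    simp_all
  · intro h k
    induction k with
    | zero => simp [descend, killed]
    | succ k ih => rw [killed_descend, ih]; simp [h k]

/-- The zero set of a coded function, if no branch is eventually labelled by `2`. -/
theorem zeroSet_codedFun {x : Seq 3} (hx : ¬ HasTail (fun a => decide (a = 2)) x) :
    zeroSet (codedFun x) = survivors x := by
  ext y
  have hl (k : ℕ) : label x (prefixOf y (k + 1)) = x (2 * descend 0 y k + y k) := by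
    rw [label, strIndex_prefixOf, descend_succ_sub_one]
  have hinf : {k | label x (prefixOf y (k + 1)) ≠ 2}.Infinite := by
    rw [Set.infinite_iff_exists_gt]
    intro N
    by_contra hc
    refine hx ⟨y, N + 1, fun k hk => ?_⟩
    by_contra h
    exact hc ⟨k, by simpa [hl] using h, by omega⟩
  rw [mem_survivors]
  simp only [zeroSet, codedFun, Set.mem_ofPred_eq]
  constructor
  · rintro ⟨h, h'⟩ k hk
    -- A label `1` is not removed, so it occurs in the output, at the position that counts the
    -- earlier labels other than `2`.
    have hk2 : (fun k => label x (prefixOf y (k + 1)) ≠ 2) k := by simp [hl, hk]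
    have := congrFun h' (Nat.count (fun k => label x (prefixOf y (k + 1)) ≠ 2) k)
    simp only [removeTwos] at this
    have := congrArg Fin.val this
    rw [Fin.val_castLT, Nat.nth_count (p := fun k => label x (prefixOf y (k + 1)) ≠ 2) hk2, hl,
      hk] at this
    simp at this
  · intro h
    refine ⟨hinf, ?_⟩
    funext j
    have h1 := Nat.nth_mem_of_infinite hinf j
    have h2 := h (Nat.nth (fun k => label x (prefixOf y (k + 1)) ≠ 2) j)
    rw [← hl] at h2
    have key : ∀ a : Fin 3, a ≠ 2 → a ≠ 1 → (a : ℕ) = 0 := by decide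
    ext
    simp only [removeTwos, Fin.val_castLT]
    exact key _ h1 h2

theorem isContinuousPartial_codedFun (x : Seq 3) : IsContinuousPartial (codedFun x) := by
  unfold IsContinuousPartial
  refine continuous_pi fun j => ?_
  refine continuous_iff_continuousAt.2 fun ⟨y, hy⟩ => ?_
  refine ContinuousAt.congr (f := fun _ => (codedFun x).fn y hy j) continuousAt_const ?_
  set p : Seq 2 → ℕ → Prop := fun y k => label x (prefixOf y (k + 1)) ≠ 2 with hp
  have hinf : {k | p y k}.Infinite := hy
  -- The `j`-th output digit at `y` is the label at level `N + 1`, so it depends only on the first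
  -- `N + 1` bits of `y`.
  set N := Nat.nth (p y) j with hN
  have hc : Continuous (fun (y : (codedFun x).Dom) (i : Fin (N + 1)) => y.1 i) :=
    continuous_pi fun i => (continuous_apply (i : ℕ)).comp continuous_subtype_val
  have hev := (hc.continuousAt (x := ⟨y, hy⟩)).eventually
    (IsOpen.eventually_mem (isOpen_discrete {fun i : Fin (N + 1) => y i}) rfl)
  filter_upwards [hev] with ⟨y', hy'⟩ h
  have hag : ∀ k ≤ N, prefixOf y' (k + 1) = prefixOf y (k + 1) := fun k hk =>
    prefixOf_eq_iff.2 fun i hi => congrFun h ⟨i, by omega⟩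
  classical
  have hcount : Nat.count (p y') N = Nat.count (p y) N := by
    rw [Nat.count, Nat.count]
    apply List.countP_congr
    intro i hi
    simp [hp, hag i (List.mem_range.1 hi).le]
  have hmem : p y N := Nat.nth_mem_of_infinite hinf j
  have hmem' : p y' N := by simpa [hp, hag N le_rfl] using hmem
  have hnth : Nat.nth (p y') j = N := by
    have h1 := Nat.nth_count hmem'
    rwa [hcount, hN, Nat.count_nth_of_infinite hinf] at h1
  simp only [PFun.fn, codedFun, removeTwos]
  ext
  simp only [Fin.val_castLT]
  change (label x (prefixOf y (Nat.nth (p y) j + 1)) : ℕ)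
    = label x (prefixOf y' (Nat.nth (p y') j + 1))
  rw [hnth, ← hN, hag N le_rfl]

/-! ### The coupling of trees and labelings -/

/-- The label of a node, computed from a uniform symbol `a`. The flag `t` says that the node has to
be extendible, the flag `d` that a label `1` occurs above it. -/
def emit (t d : Bool) (a : Fin 6) : Fin 3 :=
  if t then (if a.val % 2 = 0 then 0 else 2)
  else if d then ⟨a.val % 3, by omega⟩
  -- A node below an uncut one is labelled `1`, or not labelled `1` but without survivors, with
  -- probabilities `1 / 3` and `2 / 3 * 1 / 4 = 1 / 6`. Conditionally, label `1` gets `4 / 6` and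
  -- labels `0`, `2` get `1 / 6` each.
  else if a.val < 4 then 1 else if a.val = 4 then 0 else 2

/-- Whether a label `1` occurs on the way to a node, in the labeling `couple c z r`. -/
def cut (c : Bool) (z : Seq 3) (r : Seq 6) : ℕ → Bool
  | 0 => false
  | n + 1 => cut c z r (n / 2) ||
      decide (emit (c && nodeInTree z (n + 1)) (cut c z r (n / 2)) (r n) = 1)
  decreasing_by all_goals omega

/-- A labeling with prescribed survivors: the branches of the tree coded by `z` if `c` is true and
none if `c` is false, outside a null set of `r`. -/
def couple (c : Bool) (z : Seq 3) (r : Seq 6) : Seq 3 :=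
  fun n => emit (c && nodeInTree z (n + 1)) (cut c z r (n / 2)) (r n)

theorem killed_couple (c : Bool) (z : Seq 3) (r : Seq 6) (n : ℕ) :
    killed (couple c z r) n = cut c z r n := by
  induction n using Nat.strong_induction_on with
  | _ n ih =>
    rcases n with _ | n
    · rw [killed, cut]
    · rw [killed, cut, ih (n / 2) (by omega), couple]

theorem couple_apply (c : Bool) (z : Seq 3) (r : Seq 6) (n : ℕ) :
    couple c z r n = emit (c && nodeInTree z (n + 1)) (killed (couple c z r) (n / 2)) (r n) := by
  rw [killed_couple]; rfl

theorem killed_congr {x x' : Seq 3} {n : ℕ} (h : ∀ i < n, x i = x' i) :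
    ∀ m ≤ n, killed x m = killed x' m := by
  intro m
  induction m using Nat.strong_induction_on with
  | _ m ih =>
    intro hm
    rcases m with _ | m
    · rw [killed, killed]
    · rw [killed, killed, ih (m / 2) (by omega) (by omega), h m hm]

theorem couple_congr {c : Bool} {z z' : Seq 3} {r r' : Seq 6} {n : ℕ}
    (hz : ∀ m ≤ n, nodeInTree z m = nodeInTree z' m) (hr : ∀ i < n, r i = r' i) :
    ∀ m < n, couple c z r m = couple c z' r' m := by
  intro m
  induction m using Nat.strong_induction_on with
  | _ m ih =>
    intro hm
    rw [couple_apply, couple_apply, hz (m + 1) hm, hr m hm,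
      killed_congr (n := m / 2) (fun i hi => ih i (by omega) (by omega)) _ le_rfl]

theorem couple_congr_of_lt {c : Bool} {z z' : Seq 3} {r r' : Seq 6} {n : ℕ}
    (hz : ∀ i < n, z i = z' i) (hr : ∀ i < n, r i = r' i) :
    ∀ m < n, couple c z r m = couple c z' r' m :=
  couple_congr (nodeInTree_congr_of_lt hz) hr

theorem emit_true_ne_one : ∀ (d : Bool) (a : Fin 6), emit true d a ≠ 1 := by decide

/-- Outside the prescribed tree a branch stays uncut only through the symbols `4` and `5`. They have
probability `1 / 3`, which is below `1 / 2`, so almost surely no binary branch does so forever. -/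
theorem le_of_emit_ne_one : ∀ a : Fin 6, emit false false a ≠ 1 → decide (4 ≤ a) = true := by
  decide

theorem paths_subset_survivors_couple (z : Seq 3) (r : Seq 6) :
    paths (codedTree z) ⊆ survivors (couple true z r) := by
  intro y hy
  rw [mem_paths_codedTree] at hy
  rw [mem_survivors]
  intro k
  have h := hy (k + 1)
  rw [show descend 0 y (k + 1) = (2 * descend 0 y k + y k) + 1 by simp only [descend]; omega] at h
  rw [couple_apply, h]
  exact emit_true_ne_one _ _

/-- A surviving branch that leaves the prescribed tree has a tail of exceptional symbols. -/
theorem hasTail_of_mem_survivors {c : Bool} {z : Seq 3} {r : Seq 6} {y : Seq 2}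
    (hy : y ∈ survivors (couple c z r)) {k : ℕ}
    (hk : (c && nodeInTree z (descend 0 y k)) = false) : HasTail (fun a => decide (4 ≤ a)) r := by
  have hout : ∀ j ≥ k, (c && nodeInTree z (descend 0 y j)) = false := by
    intro j hj
    induction j, hj using Nat.le_induction with
    | base => exact hk
    | succ j hj ih =>
      cases c
      · rfl
      · rw [Bool.true_and] at ih ⊢
        by_contra hc
        rw [Bool.not_eq_false, show descend 0 y (j + 1) = (2 * descend 0 y j + y j) + 1 by
          simp only [descend]; omega] at hc
        have := nodeInTree_parent hc
        rw [descend_succ_div, ih] at this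
        exact absurd this (by simp)
  refine ⟨y, k, fun j hj => le_of_emit_ne_one _ ?_⟩
  have h1 := mem_survivors.1 hy j
  have h2 := hout (j + 1) (by omega)
  rw [show descend 0 y (j + 1) = (2 * descend 0 y j + y j) + 1 by
    simp only [descend]; omega] at h2
  rwa [couple_apply, h2, descend_succ_div, hy j] at h1

theorem survivors_couple_true {z : Seq 3} {r : Seq 6}
    (hr : ¬ HasTail (fun a => decide (4 ≤ a)) r) :
    survivors (couple true z r) = paths (codedTree z) := by
  refine Set.Subset.antisymm (fun y hy => ?_) (paths_subset_survivors_couple z r)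
  rw [mem_paths_codedTree]
  intro k
  by_contra hk
  exact hr (hasTail_of_mem_survivors hy (k := k) (by simpa using hk))

theorem survivors_couple_false {z : Seq 3} {r : Seq 6}
    (hr : ¬ HasTail (fun a => decide (4 ≤ a)) r) : survivors (couple false z r) = ∅ := by
  refine Set.eq_empty_of_forall_notMem fun y hy => hr (hasTail_of_mem_survivors hy (k := 0) rfl)

/-- A labeling with a surviving branch determines the tree from which it is obtained. -/
theorem exists_code_survivors {x : Seq 3} (hx : (survivors x).Nonempty) :
    ∃ z : Seq 3, survivors x = paths (codedTree z) ∧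
      ∀ c z' r, couple c z' r = x → ¬ HasTail (fun a => decide (4 ≤ a)) r →
        c = true ∧ z' = z := by
  obtain ⟨y₀, hy₀⟩ := hx
  -- `Q` consists of the nodes on surviving branches. It is closed under parents and has no dead
  -- ends.
  obtain ⟨z, hz⟩ := exists_code (Q := fun n => ∃ y ∈ survivors x, ∃ k, descend 0 y k = n)
    ⟨y₀, hy₀, 0, rfl⟩
    (by
      rintro n ⟨y, hy, k, hk⟩
      rcases k with _ | k
      · simp [descend] at hk
      · refine ⟨y, hy, k, ?_⟩
        have := (y k).2
        simp only [descend] at hk; omega)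
    (by
      rintro n ⟨y, hy, k, hk⟩
      have h2 : y k = 0 ∨ y k = 1 := by generalize y k = a; revert a; decide
      refine h2.imp (fun h => ?_) (fun h => ?_) <;>
      exact ⟨y, hy, k + 1, by simp [descend, hk, h]⟩)
  have hpaths : survivors x = paths (codedTree z) := by
    ext y
    rw [mem_paths_codedTree]
    refine ⟨fun hy k => (hz _).2 ⟨y, hy, k, rfl⟩, fun hy k => ?_⟩
    obtain ⟨y', hy', k', hk'⟩ := (hz _).1 (hy k)
    rw [← hk']; exact hy' k'
  refine ⟨z, hpaths, fun c z' r hc hr => ?_⟩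
  cases c
  · rw [← hc, survivors_couple_false hr] at hy₀
    exact absurd hy₀ (Set.notMem_empty _)
  · refine ⟨rfl, nodeInTree_injective fun n => ?_⟩
    -- Trees without dead ends are determined by their paths, and codes by their trees.
    have hp : paths (codedTree z') = survivors x := by rw [← hc, survivors_couple_true hr]
    rw [Bool.eq_iff_iff, hz]
    constructor
    · intro hn
      obtain ⟨y, k, hk, hy⟩ := exists_branch_through (Q := fun n => nodeInTree z' n = true)
        (fun n => nodeInTree_parent) (fun n => nodeInTree_child) hn
      exact ⟨y, hp ▸ mem_paths_codedTree.2 hy, k, hk⟩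
    · rintro ⟨y, hy, k, rfl⟩
      rw [← hp] at hy
      exact mem_paths_codedTree.1 hy k

/-! ### The uniform measure -/

instance (n : ℕ) [NeZero n] : IsProbabilityMeasure (lebesgue n) := by
  unfold lebesgue; infer_instance

theorem uniform_apply (n : ℕ) [NeZero n] (s : Finset (Fin n)) :
    (PMF.uniformOfFintype (Fin n)).toMeasure s = s.card * (n : ℝ≥0∞)⁻¹ := by
  rw [PMF.toMeasure_uniformOfFintype_apply _ s.measurableSet]
  simp [div_eq_mul_inv]

theorem lebesgue_pi {n : ℕ} [NeZero n] (s : Finset ℕ) (t : Set (Fin n)) :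
    lebesgue n (Set.pi s fun _ => t) = (PMF.uniformOfFintype (Fin n)).toMeasure t ^ s.card := by
  rw [lebesgue, Measure.infinitePi_pi _ fun _ _ => t.toFinite.measurableSet]
  simp

/-- The restriction of a sequence to its first `N` places. -/
def firstPlaces {n : ℕ} (N : ℕ) (x : Seq n) : Fin N → Fin n := fun i => x i

theorem measurable_firstPlaces {n : ℕ} (N : ℕ) : Measurable (firstPlaces (n := n) N) :=
  measurable_pi_lambda _ fun _ => measurable_pi_apply _

theorem lebesgue_firstPlaces_singleton {n : ℕ} [NeZero n] (N : ℕ) (f : Fin N → Fin n) :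
    lebesgue n (firstPlaces N ⁻¹' {f}) = (n : ℝ≥0∞)⁻¹ ^ N := by
  have : firstPlaces N ⁻¹' {f} = Set.pi (Finset.range N : Set ℕ)
      (fun i => if h : i < N then {f ⟨i, h⟩} else Set.univ) := by
    ext x
    simp only [Set.mem_preimage, Set.mem_singleton_iff, Set.mem_pi, Finset.coe_range, Set.mem_Iio]
    constructor
    · rintro rfl i hi
      simp [hi, firstPlaces]
    · intro h
      funext i
      simpa [firstPlaces] using h i i.2
  rw [this, lebesgue, Measure.infinitePi_pi _ fun _ _ => (Set.toFinite _).measurableSet]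
  rw [Finset.prod_congr rfl (g := fun _ => (n : ℝ≥0∞)⁻¹)]
  · simp
  · intro i hi
    rw [dif_pos (Finset.mem_range.1 hi)]
    rw [← Finset.coe_singleton, uniform_apply]
    simp

theorem lebesgue_firstPlaces {n : ℕ} [NeZero n] (N : ℕ) (F : Finset (Fin N → Fin n)) :
    lebesgue n (firstPlaces N ⁻¹' F) = F.card * (n : ℝ≥0∞)⁻¹ ^ N := by
  rw [← sum_measure_preimage_singleton F
    fun y _ => measurable_firstPlaces N (Set.toFinite _).measurableSet]
  simp [lebesgue_firstPlaces_singleton]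

theorem eq_preimage_firstPlaces {n N : ℕ} {A : Set (Seq n)}
    (hA : ∀ x y, (∀ i < N, x i = y i) → x ∈ A → y ∈ A) :
    A = firstPlaces N ⁻¹' (firstPlaces N '' A) := by
  refine Set.Subset.antisymm (Set.subset_preimage_image _ _) ?_
  rintro y ⟨x, hx, hxy⟩
  exact hA x y (fun i hi => congrFun hxy ⟨i, hi⟩) hx

theorem measurableSet_of_agree {n N : ℕ} {A : Set (Seq n)}
    (hA : ∀ x y, (∀ i < N, x i = y i) → x ∈ A → y ∈ A) : MeasurableSet A := by
  rw [eq_preimage_firstPlaces hA]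
  exact measurable_firstPlaces N (Set.toFinite _).measurableSet

theorem measurableSet_of_agree_prod {m n N : ℕ} {A : Set (Seq m × Seq n)}
    (hA : ∀ p q : Seq m × Seq n, (∀ i < N, p.1 i = q.1 i) → (∀ i < N, p.2 i = q.2 i) →
      p ∈ A → q ∈ A) : MeasurableSet A := by
  have : A = (fun p : Seq m × Seq n => (firstPlaces N p.1, firstPlaces N p.2)) ⁻¹'
      ((fun p : Seq m × Seq n => (firstPlaces N p.1, firstPlaces N p.2)) '' A) := by
    refine Set.Subset.antisymm (Set.subset_preimage_image _ _) ?_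
    rintro q ⟨p, hp, hpq⟩
    rw [Prod.mk.injEq] at hpq
    exact hA p q (fun i hi => congrFun hpq.1 ⟨i, hi⟩) (fun i hi => congrFun hpq.2 ⟨i, hi⟩) hp
  rw [this]
  exact (((measurable_firstPlaces N).comp measurable_fst).prodMk
    ((measurable_firstPlaces N).comp measurable_snd)) (Set.toFinite _).measurableSet

theorem measurableSet_openFamily {n : ℕ} (W : ℕ × List (Fin n) → Prop) (i : ℕ) :
    MeasurableSet (openFamily W i) := by
  have : openFamily W i = ⋃ m, {x | W (i, prefixOf x m)} := by ext; simp [mem_openFamily]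
  rw [this]
  refine MeasurableSet.iUnion fun m => measurableSet_of_agree (N := m) fun x y h hx => ?_
  simpa [← prefixOf_eq_iff.2 h] using hx

/-- A measure that gives the right mass to all sets of sequences with prescribed first `2 * N`
terms is the uniform measure. -/
theorem eq_lebesgue {n : ℕ} [NeZero n] {ν : Measure (Seq n)}
    (h : ∀ N (x : Seq n), ν {y | ∀ m < 2 * N, y m = x m} = (n : ℝ≥0∞)⁻¹ ^ (2 * N)) :
    ν = lebesgue n := by
  refine Measure.eq_infinitePi _ fun s t ht => ?_
  obtain ⟨N, hN⟩ : ∃ N, ∀ i ∈ s, i < 2 * N :=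
    ⟨s.sup id + 1, fun i hi => by have := Finset.le_sup (f := id) hi; simp at this; omega⟩
  have hmap : ν.map (firstPlaces (2 * N)) = (lebesgue n).map (firstPlaces (2 * N)) := by
    refine Measure.ext_of_singleton fun f => ?_
    rw [Measure.map_apply (measurable_firstPlaces _) (measurableSet_singleton _),
      Measure.map_apply (measurable_firstPlaces _) (measurableSet_singleton _),
      lebesgue_firstPlaces_singleton, ← h N fun i => if hi : i < 2 * N then f ⟨i, hi⟩ else 0]
    congr 1
    ext x
    simp only [Set.mem_preimage, Set.mem_singleton_iff, Set.mem_ofPred_eq]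
    constructor
    · rintro rfl i hi
      simp [hi, firstPlaces]
    · intro h
      funext i
      simpa [firstPlaces] using h i i.2
  rw [← Measure.infinitePi_pi _ fun i _ => ht i, ← lebesgue]
  have hA : ∀ x y : Seq n, (∀ i < 2 * N, x i = y i) → x ∈ Set.pi s t → y ∈ Set.pi s t :=
    fun x y hxy hx i hi => hxy i (hN i hi) ▸ hx i hi
  rw [eq_preimage_firstPlaces hA,
    ← Measure.map_apply (measurable_firstPlaces _) (Set.toFinite _).measurableSet, hmap,
    Measure.map_apply (measurable_firstPlaces _) (Set.toFinite _).measurableSet]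

/-! ### Fresh symbols -/

/-- The maps `R a` preserve `μ` and `A` and permute the fibres of `u` cyclically, so the `n` pieces
of `A` have equal mass. -/
theorem measure_inter_preimage_singleton {Ω : Type*} [MeasurableSpace Ω] {μ : Measure Ω} {n : ℕ}
    [NeZero n] {u : Ω → Fin n} (hu : Measurable u) {R : Fin n → Ω → Ω}
    (hR : ∀ a, MeasurePreserving (R a) μ μ) (hRu : ∀ a ω, u (R a ω) = u ω + a) {A : Set Ω}
    (hA : MeasurableSet A) (hRA : ∀ a ω, R a ω ∈ A ↔ ω ∈ A) (b : Fin n) :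
    μ (A ∩ u ⁻¹' {b}) = (n : ℝ≥0∞)⁻¹ * μ A := by
  have hm (b : Fin n) : MeasurableSet (A ∩ u ⁻¹' {b}) := hA.inter (hu (measurableSet_singleton b))
  have h0 (b : Fin n) : μ (A ∩ u ⁻¹' {b}) = μ (A ∩ u ⁻¹' {0}) := by
    rw [← (hR b).measure_preimage (hm b).nullMeasurableSet]
    congr 1
    ext ω
    simp [hRA, hRu]
  have hsum : μ A = ∑ b : Fin n, μ (A ∩ u ⁻¹' {b}) := by
    have := sum_measure_preimage_singleton (μ := μ.restrict A) (f := u) Finset.univ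
      fun y _ => hu (measurableSet_singleton y)
    rw [Finset.coe_univ, Set.preimage_univ, Measure.restrict_apply_univ] at this
    rw [← this]
    refine Finset.sum_congr rfl fun b _ => ?_
    rw [Measure.restrict_apply (hu (measurableSet_singleton b)), Set.inter_comm]
  rw [hsum, h0 b]
  simp only [h0, Finset.sum_const, Finset.card_univ, Fintype.card_fin, nsmul_eq_mul]
  rw [← mul_assoc, ENNReal.inv_mul_cancel (by simpa using NeZero.ne n) (by simp), one_mul]

theorem measurePreserving_rotate (n : ℕ) [NeZero n] (k : ℕ) (a : Fin n) :
    MeasurePreserving (fun z : Seq n => Function.update z k (z k + a)) (lebesgue n)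
      (lebesgue n) := by
  have hu : ((PMF.uniformOfFintype (Fin n)).toMeasure).map (· + a)
      = (PMF.uniformOfFintype (Fin n)).toMeasure := by
    refine Measure.ext_of_singleton fun b => ?_
    rw [Measure.map_apply (measurable_of_finite _) (measurableSet_singleton b)]
    have : (fun x => x + a) ⁻¹' {b} = {b - a} := by
      ext x; exact eq_sub_iff_add_eq.symm
    rw [this]
    have h1 := uniform_apply n {b - a}
    have h2 := uniform_apply n {b}
    simp only [Finset.coe_singleton, Finset.card_singleton] at h1 h2
    rw [h1, h2]
  have heq : (fun z : Seq n => Function.update z k (z k + a)) =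
      fun z i => (if i = k then (· + a) else id : Fin n → Fin n) (z i) := by
    funext z i
    by_cases h : i = k
    · subst h; simp
    · simp [h]
  rw [heq]
  refine ⟨measurable_pi_lambda _ fun i => (measurable_of_finite _).comp (measurable_pi_apply i), ?_⟩
  rw [lebesgue, Measure.infinitePi_map_pi _ fun i => measurable_of_finite _]
  congr 1
  funext i
  split_ifs
  · exact hu
  · exact Measure.map_id

theorem measure_inter_fst_eq {m n : ℕ} [NeZero m] [NeZero n] {A : Set (Seq m × Seq n)}
    (hA : MeasurableSet A) (k : ℕ)
    (hAk : ∀ z z' r, (∀ i, i ≠ k → z i = z' i) → (z, r) ∈ A → (z', r) ∈ A) (b : Fin m) :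
    ((lebesgue m).prod (lebesgue n)) (A ∩ {p | p.1 k = b})
      = (m : ℝ≥0∞)⁻¹ * ((lebesgue m).prod (lebesgue n)) A := by
  refine measure_inter_preimage_singleton (u := fun p : Seq m × Seq n => p.1 k)
    ((measurable_pi_apply k).comp measurable_fst)
    (R := fun a p => (Function.update p.1 k (p.1 k + a), p.2))
    (fun a => (measurePreserving_rotate m k a).prod (MeasurePreserving.id _))
    (fun a p => by simp) hA (fun a p => ⟨hAk _ _ _ fun i hi => ?_, hAk _ _ _ fun i hi => ?_⟩) b
  · simp [hi]
  · simp [hi]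

theorem measure_inter_snd_eq {m n : ℕ} [NeZero m] [NeZero n] {A : Set (Seq m × Seq n)}
    (hA : MeasurableSet A) (k : ℕ)
    (hAk : ∀ z r r', (∀ i, i ≠ k → r i = r' i) → (z, r) ∈ A → (z, r') ∈ A) (b : Fin n) :
    ((lebesgue m).prod (lebesgue n)) (A ∩ {p | p.2 k = b})
      = (n : ℝ≥0∞)⁻¹ * ((lebesgue m).prod (lebesgue n)) A := by
  refine measure_inter_preimage_singleton (u := fun p : Seq m × Seq n => p.2 k)
    ((measurable_pi_apply k).comp measurable_snd)
    (R := fun a p => (p.1, Function.update p.2 k (p.2 k + a)))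
    (fun a => (MeasurePreserving.id _).prod (measurePreserving_rotate n k a))
    (fun a p => by simp) hA (fun a p => ⟨hAk _ _ _ fun i hi => ?_, hAk _ _ _ fun i hi => ?_⟩) b
  · simp [hi]
  · simp [hi]

/-! ### Branches with a tail in a small set of labels -/

/-- The length of the chains below the node `q` in the `i`-th set of the test `chain`. -/
def chainLength (i q : ℕ) : ℕ := 2 * (q + 1 + i)

/-- The place of the label of the `j`-th node, from the bottom, of a chain of length `s` below the
node `q`. -/
def chainPlace (s q t j : ℕ) : ℕ := ((q + 1) * 2 ^ s + t) / 2 ^ j - 2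

/-- A test that covers all labelings with `HasTail S`: below some node `q` there is a long chain
of nodes with labels in `S`. -/
def chain {n : ℕ} [NeZero n] (S : Fin n → Bool) (p : ℕ × List (Fin n)) : Prop :=
  ∃ q < p.2.length, ∃ t < 2 ^ chainLength p.1 q, ∀ j < chainLength p.1 q,
    chainPlace (chainLength p.1 q) q t j < p.2.length ∧
      S (p.2.getD (chainPlace (chainLength p.1 q) q t j) 0) = true

theorem getD_prefixOf {n : ℕ} (x : Seq n) {N i : ℕ} (h : i < N) (d : Fin n) :
    (prefixOf x N).getD i d = x i := by
  simp [prefixOf, List.getD_eq_getElem?_getD, h]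

theorem chainPlace_le (s q t j : ℕ) : chainPlace s q t j ≤ chainPlace s q t 0 := by
  unfold chainPlace
  have := Nat.div_le_self ((q + 1) * 2 ^ s + t) (2 ^ j)
  simp only [pow_zero, Nat.div_one]; omega

/-- Guarantees that the truncated subtraction in `chainPlace` never truncates. -/
theorem two_le_div {s q t j : ℕ} (hj : j < s) : 2 ≤ ((q + 1) * 2 ^ s + t) / 2 ^ j := by
  rw [Nat.le_div_iff_mul_le (by positivity)]
  have : 2 * 2 ^ j ≤ 2 ^ s := by rw [← pow_succ']; exact Nat.pow_le_pow_right (by norm_num) hj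
  nlinarith [Nat.zero_le q, Nat.zero_le t, Nat.zero_le (q * 2 ^ s)]

theorem chainPlace_injOn (s q t : ℕ) : Set.InjOn (chainPlace s q t) (Set.Iio s) := by
  have key : ∀ i j, i < j → j < s → chainPlace s q t i ≠ chainPlace s q t j := by
    intro i j hij hj h
    have h1 := two_le_div (q := q) (t := t) (hij.trans hj)
    have h2 := two_le_div (q := q) (t := t) hj
    have h3 : ((q + 1) * 2 ^ s + t) / 2 ^ j ≤ ((q + 1) * 2 ^ s + t) / 2 ^ i / 2 := by
      rw [Nat.div_div_eq_div_mul, ← pow_succ]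
      exact Nat.div_le_div_left (Nat.pow_le_pow_right (by norm_num) hij) (by positivity)
    unfold chainPlace at h
    omega
  intro i hi j hj h
  rcases lt_trichotomy i j with hij | hij | hij
  · exact absurd h (key i j hij hj)
  · exact hij
  · exact absurd h.symm (key j i hij hi)

/-- The length bounds in `chain` only make it decidable from a finite string; a long enough prefix
satisfies them. -/
theorem mem_openFamily_chain {n : ℕ} [NeZero n] {S : Fin n → Bool} {i : ℕ} {x : Seq n} :
    x ∈ openFamily (chain S) i ↔ ∃ q, ∃ t < 2 ^ chainLength i q, ∀ j < chainLength i q,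
      S (x (chainPlace (chainLength i q) q t j)) = true := by
  rw [mem_openFamily]
  constructor
  · rintro ⟨m, q, -, t, ht, h⟩
    refine ⟨q, t, ht, fun j hj => ?_⟩
    obtain ⟨h1, h2⟩ := h j hj
    simp only [length_prefixOf] at h1
    rwa [getD_prefixOf x h1] at h2
  · rintro ⟨q, t, ht, h⟩
    refine ⟨q + chainPlace (chainLength i q) q t 0 + 1, q, by rw [length_prefixOf]; omega, t, ht,
      fun j hj => ?_⟩
    have h1 := chainPlace_le (chainLength i q) q t j
    simp only [length_prefixOf]
    refine ⟨by omega, ?_⟩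
    rw [getD_prefixOf x (by omega)]
    exact h j hj

theorem mem_chain_of_hasTail {n : ℕ} [NeZero n] {S : Fin n → Bool} {x : Seq n}
    (hx : HasTail S x) (i : ℕ) : x ∈ openFamily (chain S) i := by
  obtain ⟨y, N, h⟩ := hx
  rw [mem_openFamily_chain]
  set q := descend 0 y N
  set s := chainLength i q
  -- The bottom of the chain is the node `s` levels below `q` on the branch `y`; `t` records the
  -- directions taken from `q`.
  set u := descend 0 y (N + s) + 1
  have hu : u / 2 ^ s = q + 1 := descend_add_one_div y 0 N s
  have hu' : (q + 1) * 2 ^ s + u % 2 ^ s = u := by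
    rw [← hu, mul_comm]; exact Nat.div_add_mod _ _
  refine ⟨q, u % 2 ^ s, Nat.mod_lt _ (by positivity), fun j hj => ?_⟩
  rw [chainPlace, hu']
  obtain ⟨k, hk⟩ : ∃ k, N + s = (N + k + 1) + j := ⟨s - j - 1, by omega⟩
  have : u / 2 ^ j = descend 0 y (N + k + 1) + 1 := by
    simp only [u]; rw [hk]; exact descend_add_one_div y 0 _ j
  rw [this]
  have h2 := h (N + k) (by omega)
  rw [← descend_succ_sub_one] at h2
  rwa [show descend 0 y (N + k + 1) + 1 - 2 = descend 0 y (N + k + 1) - 1 by omega]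

/-- Below `q` there are `2 ^ s` chains, and each lies in `S` with probability at most `3⁻¹ ^ s`
because its places are distinct. For `s = 2 * (q + 1 + i)` the bound `(4 / 9) ^ (q + 1 + i)` is
summable over `q`. -/
theorem lebesgue_chain_le {n : ℕ} [NeZero n] {S : Fin n → Bool}
    (hS : 3 * (Finset.univ.filter fun a => S a = true).card ≤ n) (i : ℕ) :
    lebesgue n (openFamily (chain S) i) ≤ (2 : ℝ≥0∞)⁻¹ ^ i := by
  have hunif : (PMF.uniformOfFintype (Fin n)).toMeasure {a | S a = true} ≤ 3⁻¹ := by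
    have h1 := uniform_apply n (Finset.univ.filter fun a => S a = true)
    rw [Finset.coe_filter_univ] at h1
    rw [h1, ← div_eq_mul_inv]
    refine ENNReal.div_le_of_le_mul ?_
    rw [← ENNReal.mul_le_mul_iff_right (a := 3) (by norm_num) (by norm_num), ← mul_assoc,
      ENNReal.mul_inv_cancel (by norm_num) (by norm_num), one_mul]
    exact_mod_cast hS
  have hone (q t : ℕ) : lebesgue n {x | ∀ j < chainLength i q,
      S (x (chainPlace (chainLength i q) q t j)) = true} ≤ 3⁻¹ ^ chainLength i q := by
    have : {x : Seq n | ∀ j < chainLength i q,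
        S (x (chainPlace (chainLength i q) q t j)) = true} =
        Set.pi (((Finset.range (chainLength i q)).image (chainPlace (chainLength i q) q t) :
          Finset ℕ) : Set ℕ) fun _ => {a | S a = true} := by
      ext x; simp
    rw [this, lebesgue_pi, Finset.card_image_of_injOn
      (by simpa using chainPlace_injOn (chainLength i q) q t), Finset.card_range]
    gcongr
  have hcover : openFamily (chain S) i ⊆ ⋃ q, ⋃ t ∈ Finset.range (2 ^ chainLength i q),
      {x | ∀ j < chainLength i q, S (x (chainPlace (chainLength i q) q t j)) = true} := by
    intro x hx
    obtain ⟨q, t, ht, h⟩ := mem_openFamily_chain.1 hx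
    simp only [Set.mem_iUnion]
    exact ⟨q, t, Finset.mem_range.2 ht, h⟩
  have hq (q : ℕ) : lebesgue n (⋃ t ∈ Finset.range (2 ^ chainLength i q),
      {x | ∀ j < chainLength i q, S (x (chainPlace (chainLength i q) q t j)) = true})
      ≤ 2⁻¹ ^ i * 2⁻¹ ^ (q + 1) := by
    refine (measure_biUnion_finset_le _ _).trans ((Finset.sum_le_sum fun t _ => hone q t).trans ?_)
    rw [Finset.sum_const, Finset.card_range, nsmul_eq_mul, ← pow_add]
    push_cast
    rw [← mul_pow, chainLength, pow_mul, show i + (q + 1) = q + 1 + i by ring]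
    gcongr
    -- The factor `2` in `chainLength` is needed because `2 / 3` exceeds `1 / 2`, but its square `4
    -- / 9` does not.
    have h3 : (2 * 3⁻¹ : ℝ≥0∞) ^ 2 = ENNReal.ofReal (4 / 9) := by
      rw [show (2 * 3⁻¹ : ℝ≥0∞) = ENNReal.ofReal (2 * 3⁻¹) by
        rw [ENNReal.ofReal_mul (by norm_num), ENNReal.ofReal_inv_of_pos (by norm_num)]; simp,
        ← ENNReal.ofReal_pow (by norm_num)]
      norm_num
    have h4 : (2⁻¹ : ℝ≥0∞) = ENNReal.ofReal 2⁻¹ := by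
      rw [ENNReal.ofReal_inv_of_pos (by norm_num)]; simp
    rw [h3, h4]
    exact ENNReal.ofReal_le_ofReal (by norm_num)
  refine (measure_mono hcover).trans ((measure_iUnion_le _).trans
    ((ENNReal.tsum_le_tsum hq).trans ?_))
  rw [ENNReal.tsum_mul_left]
  have : ∑' q : ℕ, (2⁻¹ : ℝ≥0∞) ^ (q + 1) = 1 := by
    rw [ENNReal.tsum_geometric_add_one, ENNReal.one_sub_inv_two, inv_inv,
      ENNReal.inv_mul_cancel (by norm_num) (by norm_num)]
  rw [this, mul_one]

/-! ### The law of the coupling -/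

/-- The distribution of the two inputs of `couple`. -/
noncomputable abbrev inputs : Measure (Seq 3 × Seq 6) := (lebesgue 3).prod (lebesgue 6)

theorem rank_congr {z z' : Seq 3} {n : ℕ} (h : ∀ m < n, nodeInTree z m = nodeInTree z' m) :
    rank z n = rank z' n := by
  unfold rank
  rw [Nat.count, Nat.count]
  apply List.countP_congr
  intro j hj
  simp [h j (List.mem_range.1 hj)]

/-- The symbols that determine the labels of the two children of the node `n`. -/
def freshSymbols (n : ℕ) (p : Seq 3 × Seq 6) : Fin 3 × Fin 6 × Fin 6 :=
  (p.1 (rank p.1 n), p.2 (2 * n), p.2 (2 * n + 1))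

theorem measurable_freshSymbols (n : ℕ) : Measurable (freshSymbols n) := by
  refine measurable_to_countable' fun a => measurableSet_of_agree_prod (N := 2 * n + 2) ?_
  rintro p q h1 h2 rfl
  have hr : rank p.1 n = rank q.1 n :=
    rank_congr fun m hm => nodeInTree_congr_of_lt h1 m (by omega)
  have := rank_le p.1 n
  simp only [Set.mem_preimage, freshSymbols, Set.mem_singleton_iff, ← hr]
  rw [h1 _ (by omega), h2 _ (by omega), h2 _ (by omega)]

/-- The symbols read at the node `n` are uniformly distributed and independent of the tree up to the
node `2 * n` and of the first `2 * n` symbols of the second input. -/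
theorem inputs_inter_freshSymbols {n : ℕ} {A : Set (Seq 3 × Seq 6)}
    (hA : ∀ z z' r r', (∀ m ≤ 2 * n, nodeInTree z m = nodeInTree z' m) →
      (∀ i < 2 * n, r i = r' i) → (z, r) ∈ A → (z', r') ∈ A) (g : Fin 3 × Fin 6 × Fin 6) :
    inputs (A ∩ freshSymbols n ⁻¹' {g}) = 6⁻¹ * (6⁻¹ * (3⁻¹ * inputs A)) := by
  have hmeas : MeasurableSet A := measurableSet_of_agree_prod (N := 2 * n) fun p q h1 h2 =>
    hA p.1 q.1 p.2 q.2 (nodeInTree_congr_of_lt h1) h2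
  have hrank : Measurable fun p : Seq 3 × Seq 6 => rank p.1 n := by
    refine measurable_to_countable' fun a => measurableSet_of_agree_prod (N := n) ?_
    rintro p q h1 - rfl
    exact (rank_congr fun m hm => nodeInTree_congr_of_lt h1 m hm.le).symm
  have hread : MeasurableSet {p : Seq 3 × Seq 6 | p.1 (rank p.1 n) = g.1} :=
    (measurable_fst.comp (measurable_freshSymbols n)) (measurableSet_singleton g.1)
  have hpart (B : Set (Seq 3 × Seq 6)) : inputs B =
      ∑ k ∈ Finset.range (n + 1), inputs ((fun p => rank p.1 n) ⁻¹' {k} ∩ B) := by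
    have := sum_measure_preimage_singleton (μ := inputs.restrict B)
      (f := fun p : Seq 3 × Seq 6 => rank p.1 n) (Finset.range (n + 1))
      fun y _ => hrank (measurableSet_singleton y)
    rw [show (fun p : Seq 3 × Seq 6 => rank p.1 n) ⁻¹' (Finset.range (n + 1) : Set ℕ) = Set.univ by
      ext p; simpa using Nat.lt_succ_of_le (rank_le p.1 n), Measure.restrict_apply_univ] at this
    rw [← this]
    exact Finset.sum_congr rfl fun k _ =>
      Measure.restrict_apply (hrank (measurableSet_singleton k))
  have hz : inputs (A ∩ {p | p.1 (rank p.1 n) = g.1}) = 3⁻¹ * inputs A := by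
    rw [hpart, hpart A, Finset.mul_sum]
    refine Finset.sum_congr rfl fun k _ => ?_
    have := measure_inter_fst_eq (A := (fun p : Seq 3 × Seq 6 => rank p.1 n) ⁻¹' {k} ∩ A)
      ((hrank (measurableSet_singleton k)).inter hmeas) k (by
        rintro z z' r hzz ⟨rfl, h2⟩
        have htree : ∀ m ≤ 2 * n, nodeInTree z m = nodeInTree z' m := by
          -- Where the rank of `n` is `k`, the symbol `k` is first read at `n` and only affects the
          -- children of `n`, which come after `2 * n`. So it may be rotated freely.
          refine nodeInTree_congr (k := rank z n) (fun m hm => ?_) fun i hi => hzz i (Nat.ne_of_lt hi)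
          have h3 := rank_mono z (show m + 1 ≤ n by omega)
          rw [rank_succ] at h3
          cases h : nodeInTree z m
          · exact .inr rfl
          · rw [h] at h3; simp at h3; exact .inl (by omega)
        exact ⟨(rank_congr fun m hm => htree m (by omega)).symm,
          hA z z' r r htree (fun _ _ => rfl) h2⟩) g.1
    rw [show ((3 : ℕ) : ℝ≥0∞) = 3 by norm_num] at this
    rw [← this]
    congr 1
    ext p
    simp only [Set.mem_inter_iff, Set.mem_preimage, Set.mem_singleton_iff, Set.mem_ofPred_eq]
    constructor
    · rintro ⟨rfl, h1, h2⟩; exact ⟨⟨rfl, h1⟩, h2⟩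
    · rintro ⟨⟨rfl, h1⟩, h2⟩; exact ⟨rfl, h1, h2⟩
  have h6 : ((6 : ℕ) : ℝ≥0∞) = 6 := by norm_num
  have hr := measure_inter_snd_eq (hmeas.inter hread) (2 * n) (by
    rintro z r r' h ⟨h1, h2⟩
    exact ⟨hA z z r r' (fun _ _ => rfl) (fun i hi => h i (by omega)) h1, h2⟩) g.2.1
  have hr' := measure_inter_snd_eq ((hmeas.inter hread).inter
    ((measurable_pi_apply (2 * n)).comp measurable_snd (measurableSet_singleton g.2.1)))
    (2 * n + 1) (by
      rintro z r r' h ⟨⟨h1, h2⟩, h3⟩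
      exact ⟨⟨hA z z r r' (fun _ _ => rfl) (fun i hi => h i (by omega)) h1, h2⟩,
        (h (2 * n) (by omega)).symm.trans h3⟩) g.2.2
  rw [h6] at hr hr'
  rw [← hz, ← hr]
  refine Eq.trans ?_ hr'
  congr 1
  ext p
  simp only [freshSymbols, Set.mem_inter_iff, Set.mem_preimage, Set.mem_singleton_iff,
    Set.mem_ofPred_eq, Prod.ext_iff, Function.comp_apply]
  tauto

theorem inputs_real_inter_freshSymbols {n : ℕ} {A : Set (Seq 3 × Seq 6)}
    (hA : ∀ z z' r r', (∀ m ≤ 2 * n, nodeInTree z m = nodeInTree z' m) →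
      (∀ i < 2 * n, r i = r' i) → (z, r) ∈ A → (z', r') ∈ A)
    (G : Finset (Fin 3 × Fin 6 × Fin 6)) :
    inputs.real (A ∩ freshSymbols n ⁻¹' G) = G.card / 108 * inputs.real A := by
  have h1 : inputs (A ∩ freshSymbols n ⁻¹' G) = G.card * (6⁻¹ * (6⁻¹ * (3⁻¹ * inputs A))) := by
    have := sum_measure_preimage_singleton (μ := inputs.restrict A) (f := freshSymbols n) G
      fun y _ => measurable_freshSymbols n (measurableSet_singleton y)
    rw [Measure.restrict_apply (measurable_freshSymbols n G.measurableSet), Set.inter_comm] at this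
    rw [← this, Finset.sum_congr rfl fun g _ => by
      rw [Measure.restrict_apply (measurable_freshSymbols n (measurableSet_singleton g)),
        Set.inter_comm, inputs_inter_freshSymbols hA]]
    simp
  rw [Measure.real, h1, Measure.real]
  simp only [ENNReal.toReal_mul, ENNReal.toReal_inv, ENNReal.toReal_natCast, ENNReal.toReal_ofNat]
  ring

/-- The event that the first `2 * n` labels are those of `x` and that `τ` lists which nodes from `j`
to `2 * n` are prescribed to be extendible. -/
def stage (c : Bool) (x : Seq 3) (τ : ℕ → Bool) (n j : ℕ) : Set (Seq 3 × Seq 6) :=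
  {p | (∀ m < 2 * n, couple c p.1 p.2 m = x m) ∧
    ∀ m, j ≤ m → m ≤ 2 * n → (c && nodeInTree p.1 m) = τ m}

theorem stage_congr {c : Bool} {x : Seq 3} {τ : ℕ → Bool} {n j : ℕ} (z z' : Seq 3) (r r' : Seq 6)
    (hz : ∀ m ≤ 2 * n, nodeInTree z m = nodeInTree z' m) (hr : ∀ i < 2 * n, r i = r' i)
    (h : (z, r) ∈ stage c x τ n j) : (z', r') ∈ stage c x τ n j :=
  ⟨fun m hm => (couple_congr hz hr m hm).symm.trans (h.1 m hm),
    fun m hm hm' => by rw [← hz m hm']; exact h.2 m hm hm'⟩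

theorem measurableSet_stage (c : Bool) (x : Seq 3) (τ : ℕ → Bool) (n j : ℕ) :
    MeasurableSet (stage c x τ n j) :=
  measurableSet_of_agree_prod (N := 2 * n) fun p q h1 h2 =>
    stage_congr p.1 q.1 p.2 q.2 (nodeInTree_congr_of_lt h1) h2

theorem mem_stage_update {c : Bool} {x : Seq 3} {τ : ℕ → Bool} {n j : ℕ} (hj : j ≤ 2 * n) {b : Bool}
    {p : Seq 3 × Seq 6} : p ∈ stage c x (Function.update τ j b) n j ↔
      p ∈ stage c x τ n (j + 1) ∧ (c && nodeInTree p.1 j) = b := by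
  constructor
  · rintro ⟨h1, h2⟩
    refine ⟨⟨h1, fun m hm hm' => ?_⟩, by simpa using h2 j le_rfl hj⟩
    simpa [show m ≠ j by omega] using h2 m (by omega) hm'
  · rintro ⟨⟨h1, h2⟩, h3⟩
    refine ⟨h1, fun m hm hm' => ?_⟩
    rcases hm.eq_or_lt with rfl | hm
    · simpa using h3
    · simpa [show m ≠ j by omega] using h2 m hm hm'

theorem disjoint_stage_update {c : Bool} {x : Seq 3} {τ : ℕ → Bool} {n j : ℕ} (hj : j ≤ 2 * n) :
    Disjoint (stage c x (Function.update τ j true) n j)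
      (stage c x (Function.update τ j false) n j) := by
  refine Set.disjoint_left.2 fun p h1 h2 => ?_
  have h1 := ((mem_stage_update hj).1 h1).2
  have h2 := ((mem_stage_update hj).1 h2).2
  rw [h1] at h2
  exact absurd h2 (by simp)

/-- Forgets the flag of node `j` by summing over its two values. -/
theorem real_stage_succ {c : Bool} {x : Seq 3} {τ : ℕ → Bool} {n j : ℕ} (hj : j ≤ 2 * n) :
    inputs.real (stage c x τ n (j + 1)) =
      inputs.real (stage c x (Function.update τ j true) n j) +
      inputs.real (stage c x (Function.update τ j false) n j) := by
  rw [← measureReal_union (disjoint_stage_update hj) (measurableSet_stage _ _ _ _ _)]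
  congr 1
  ext p
  rw [Set.mem_union, mem_stage_update hj, mem_stage_update hj]
  cases c && nodeInTree p.1 j <;> simp

/-- The fresh symbols that lead to labels `l`, `l'` and flags `t`, `t'` of the children of a node
with flags `b` and `d`. -/
def goodSymbols (b d t t' : Bool) (l l' : Fin 3) : Finset (Fin 3 × Fin 6 × Fin 6) :=
  Finset.univ.filter fun g => (b && decide (g.1 ≠ 1)) = t ∧ (b && decide (g.1 ≠ 0)) = t' ∧
    emit t d g.2.1 = l ∧ emit t' d g.2.2 = l'

/-- Passing from `n` to `n + 1` reveals the labels and flags of the children `2 * n + 1` and `2 * n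
+ 2`. Given the flags of `n`, these depend only on the fresh symbols. -/
theorem mem_stage_succ {c : Bool} {x : Seq 3} {τ : ℕ → Bool} {n : ℕ} {p : Seq 3 × Seq 6} :
    p ∈ stage c x τ (n + 1) (n + 1) ↔ p ∈ stage c x τ n (n + 1) ∧
      freshSymbols n p ∈ goodSymbols (c && nodeInTree p.1 n) (killed x n) (τ (2 * n + 1))
        (τ (2 * n + 2)) (x (2 * n)) (x (2 * n + 1)) := by
  have ht1 : (c && nodeInTree p.1 (2 * n + 1))
      = ((c && nodeInTree p.1 n) && decide (p.1 (rank p.1 n) ≠ 1)) := by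
    rw [nodeInTree_left, Bool.and_assoc]
  have ht2 : (c && nodeInTree p.1 (2 * n + 2))
      = ((c && nodeInTree p.1 n) && decide (p.1 (rank p.1 n) ≠ 0)) := by
    rw [nodeInTree_right, Bool.and_assoc]
  have hx (h : ∀ m < 2 * n, couple c p.1 p.2 m = x m) :
      couple c p.1 p.2 (2 * n) = emit (c && nodeInTree p.1 (2 * n + 1)) (killed x n)
        (p.2 (2 * n)) ∧
      couple c p.1 p.2 (2 * n + 1) = emit (c && nodeInTree p.1 (2 * n + 2)) (killed x n)
        (p.2 (2 * n + 1)) := by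
    have hk := killed_congr h n (by omega)
    rw [couple_apply, couple_apply, show 2 * n / 2 = n by omega,
      show (2 * n + 1) / 2 = n by omega, hk]
    exact ⟨rfl, rfl⟩
  simp only [goodSymbols, Finset.mem_filter, Finset.mem_univ, true_and, freshSymbols, ← ht1, ← ht2]
  constructor
  · rintro ⟨h1, h2⟩
    have h1' : ∀ m < 2 * n, couple c p.1 p.2 m = x m := fun m hm => h1 m (by omega)
    have e1 := h2 (2 * n + 1) (by omega) (by omega)
    have e2 := h2 (2 * n + 2) (by omega) (by omega)
    refine ⟨⟨h1', fun m hm hm' => h2 m hm (by omega)⟩, e1, e2, ?_, ?_⟩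
    · rw [← e1, ← (hx h1').1]; exact h1 _ (by omega)
    · rw [← e2, ← (hx h1').2]; exact h1 _ (by omega)
  · rintro ⟨⟨h1, h2⟩, e1, e2, e3, e4⟩
    rw [← e1, ← (hx h1).1] at e3
    rw [← e2, ← (hx h1).2] at e4
    refine ⟨fun m hm => ?_, fun m hm hm' => ?_⟩
    · rcases (show m < 2 * n ∨ m = 2 * n ∨ m = 2 * n + 1 by omega) with h | rfl | rfl
      · exact h1 m h
      · exact e3
      · exact e4
    · rcases (show m ≤ 2 * n ∨ m = 2 * n + 1 ∨ m = 2 * n + 2 by omega) with h | rfl | rfl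
      · exact h2 m hm h
      · exact e1
      · exact e2

theorem real_stage_step {c : Bool} {x : Seq 3} {τ : ℕ → Bool} {n : ℕ} :
    inputs.real (stage c x τ (n + 1) (n + 1)) =
      (goodSymbols true (killed x n) (τ (2 * n + 1)) (τ (2 * n + 2)) (x (2 * n))
        (x (2 * n + 1))).card / 108 * inputs.real (stage c x (Function.update τ n true) n n) +
      (goodSymbols false (killed x n) (τ (2 * n + 1)) (τ (2 * n + 2)) (x (2 * n))
        (x (2 * n + 1))).card / 108 * inputs.real (stage c x (Function.update τ n false) n n) := by
  have hn : n ≤ 2 * n := by omega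
  rw [← inputs_real_inter_freshSymbols stage_congr, ← inputs_real_inter_freshSymbols stage_congr,
    ← measureReal_union ((disjoint_stage_update hn).mono Set.inter_subset_left
      Set.inter_subset_left) ((measurableSet_stage _ _ _ _ _).inter
      (measurable_freshSymbols n (Finset.measurableSet _)))]
  congr 1
  ext p
  simp only [Set.mem_union, Set.mem_inter_iff, mem_stage_update hn, Set.mem_preimage,
    Finset.mem_coe]
  rw [mem_stage_succ]
  cases c && nodeInTree p.1 n <;> simp

/-- Four times the conditional probability of the flag `t` at a node with the flag `d`. -/
def weight (d t : Bool) : ℕ :=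
  if d then (if t then 0 else 4) else (if t then 3 else 1)

/-- One step of the branching process: averaged over the flag of the parent, each pair of child
labels has probability `1 / 9`. Given these labels, the flags of the children are independent, with
survival probability `3 / 4`, or `0` if cut off. -/
theorem weight_goodSymbols : ∀ (d t t' : Bool) (l l' : Fin 3),
    weight d true * (goodSymbols true d t t' l l').card +
      weight d false * (goodSymbols false d t t' l l').card =
      3 * (weight (d || decide (l = 1)) t * weight (d || decide (l' = 1)) t') := by
  decide

/-- The mass of `stage`, if the root is prescribed to be extendible with probability `3 / 4`. -/
noncomputable def stageMass (x : Seq 3) (τ : ℕ → Bool) (n j : ℕ) : ℝ :=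
  3 / 4 * inputs.real (stage true x τ n j) + 1 / 4 * inputs.real (stage false x τ n j)

theorem prod_weight_update (x : Seq 3) (τ : ℕ → Bool) {j N : ℕ} (hj : j < N) (b : Bool) :
    ∏ m ∈ Finset.Ico j N, (weight (killed x m) (Function.update τ j b m) / 4 : ℝ) =
      weight (killed x j) b / 4 *
        ∏ m ∈ Finset.Ico (j + 1) N, (weight (killed x m) (τ m) / 4 : ℝ) := by
  rw [Finset.prod_eq_prod_Ico_succ_bot hj, Function.update_self]
  congr 1
  refine Finset.prod_congr rfl fun m hm => ?_
  rw [Function.update_of_ne (by simp at hm; omega)]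

/-- The two weights at a node add up to `4`, so summing out the flag of `j` deletes its factor. -/
theorem stageMass_succ {x : Seq 3} {n j : ℕ} (hj : j ≤ 2 * n)
    (h : ∀ τ, stageMass x τ n j
      = (1 / 9) ^ n * ∏ m ∈ Finset.Ico j (2 * n + 1), (weight (killed x m) (τ m) / 4 : ℝ))
    (τ : ℕ → Bool) : stageMass x τ n (j + 1)
      = (1 / 9) ^ n * ∏ m ∈ Finset.Ico (j + 1) (2 * n + 1), (weight (killed x m) (τ m) / 4 : ℝ) := by
  have hsplit : stageMass x τ n (j + 1) = stageMass x (Function.update τ j true) n j +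
      stageMass x (Function.update τ j false) n j := by
    simp only [stageMass, real_stage_succ hj]; ring
  rw [hsplit, h, h, prod_weight_update x τ (by omega), prod_weight_update x τ (by omega)]
  cases killed x j
  · simp [weight]; ring
  · simp [weight]

/-- The nodes from `n` to `2 * n` are the frontier: they are labelled, but their children are not.
Inductively, given the labels, their flags are independent. Processing `n` replaces its factor by
those of its two children. -/
theorem stageMass_eq (x : Seq 3) (n : ℕ) (τ : ℕ → Bool) : stageMass x τ n n
    = (1 / 9) ^ n * ∏ m ∈ Finset.Ico n (2 * n + 1), (weight (killed x m) (τ m) / 4 : ℝ) := by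
  induction n generalizing τ with
  | zero =>
    have hs (c : Bool) : stage c x τ 0 0 = {_p | c = τ 0} := by
      ext p
      simp [stage]
    simp only [stageMass, hs]
    cases h : τ 0 <;> simp [weight, killed, h]
  | succ n ih =>
    have hstep : stageMass x τ (n + 1) (n + 1) =
        (goodSymbols true (killed x n) (τ (2 * n + 1)) (τ (2 * n + 2)) (x (2 * n))
          (x (2 * n + 1))).card / 108 * stageMass x (Function.update τ n true) n n +
        (goodSymbols false (killed x n) (τ (2 * n + 1)) (τ (2 * n + 2)) (x (2 * n))
          (x (2 * n + 1))).card / 108 * stageMass x (Function.update τ n false) n n := by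
      simp only [stageMass, real_stage_step]; ring
    have hw := weight_goodSymbols (killed x n) (τ (2 * n + 1)) (τ (2 * n + 2)) (x (2 * n))
      (x (2 * n + 1))
    have hk1 : killed x (2 * n + 1) = (killed x n || decide (x (2 * n) = 1)) := by
      rw [killed, show 2 * n / 2 = n by omega]
    have hk2 : killed x (2 * n + 2) = (killed x n || decide (x (2 * n + 1) = 1)) := by
      rw [killed, show (2 * n + 1) / 2 = n by omega]
    rw [← hk1, ← hk2] at hw
    rw [hstep, ih, ih, prod_weight_update x τ (by omega), prod_weight_update x τ (by omega),
      show 2 * (n + 1) + 1 = (2 * n + 1) + 1 + 1 by ring,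
      Finset.prod_Ico_succ_top (show n + 1 ≤ 2 * n + 1 + 1 by omega),
      Finset.prod_Ico_succ_top (show n + 1 ≤ 2 * n + 1 by omega), pow_succ]
    have hw' := congrArg (Nat.cast (R := ℝ)) hw
    push_cast at hw'
    generalize ∏ m ∈ Finset.Ico (n + 1) (2 * n + 1), (weight (killed x m) (τ m) / 4 : ℝ) = P
    -- `432` is `4 * 108`: the scale of the parent's weight times the number `3 * 6 * 6` of fresh
    -- symbol triples.
    linear_combination (1 / 9) ^ n * P / 432 * hw'

theorem real_couple_cylinder (x : Seq 3) (n : ℕ) :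
    3 / 4 * inputs.real {p | ∀ m < 2 * n, couple true p.1 p.2 m = x m} +
      1 / 4 * inputs.real {p | ∀ m < 2 * n, couple false p.1 p.2 m = x m} = (1 / 9) ^ n := by
  have key : ∀ j, n ≤ j → j ≤ 2 * n + 1 → ∀ τ, stageMass x τ n j
      = (1 / 9) ^ n * ∏ m ∈ Finset.Ico j (2 * n + 1), (weight (killed x m) (τ m) / 4 : ℝ) := by
    intro j hj
    induction j, hj using Nat.le_induction with
    | base => exact fun _ => stageMass_eq x n
    | succ j hj ih => exact fun hj' => stageMass_succ (by omega) (ih (by omega))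
  -- At `j = 2 * n + 1` all frontier flags are summed out and the product is empty, leaving the law
  -- of the labels alone.
  have h := key (2 * n + 1) (by omega) le_rfl fun _ => false
  have hs (c : Bool) : stage c x (fun _ => false) n (2 * n + 1)
      = {p | ∀ m < 2 * n, couple c p.1 p.2 m = x m} := by
    ext p
    exact ⟨fun h => h.1, fun h => ⟨h, fun m h1 h2 => by omega⟩⟩
  simpa [stageMass, hs] using h

theorem measurable_couple (c : Bool) :
    Measurable fun p : Seq 3 × Seq 6 => couple c p.1 p.2 := by
  refine measurable_pi_lambda _ fun n => measurable_to_countable' fun a =>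
    measurableSet_of_agree_prod (N := n + 1) ?_
  rintro p q h1 h2 rfl
  exact (couple_congr_of_lt h1 h2 n (by omega)).symm

/-- The law of `couple`: a uniformly distributed labeling is obtained if the root is prescribed to
be extendible with probability `3 / 4`. -/
theorem lebesgue_eq_couple {U : Set (Seq 3)} (hU : MeasurableSet U) :
    lebesgue 3 U = ENNReal.ofReal (3 / 4) * inputs {p | couple true p.1 p.2 ∈ U} +
      ENNReal.ofReal (1 / 4) * inputs {p | couple false p.1 p.2 ∈ U} := by
  have happ {V : Set (Seq 3)} (hV : MeasurableSet V) :
      (ENNReal.ofReal (3 / 4) • inputs.map (fun p => couple true p.1 p.2) +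
        ENNReal.ofReal (1 / 4) • inputs.map (fun p => couple false p.1 p.2)) V =
      ENNReal.ofReal (3 / 4) * inputs {p | couple true p.1 p.2 ∈ V} +
        ENNReal.ofReal (1 / 4) * inputs {p | couple false p.1 p.2 ∈ V} := by
    rw [Measure.add_apply, Measure.smul_apply, Measure.smul_apply,
      Measure.map_apply (measurable_couple _) hV, Measure.map_apply (measurable_couple _) hV]
    rfl
  rw [← happ hU]
  congr 1
  refine (eq_lebesgue fun N x => ?_).symm
  have hmeas : MeasurableSet {y : Seq 3 | ∀ m < 2 * N, y m = x m} :=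
    measurableSet_of_agree (N := 2 * N) fun y y' h hy m hm => (h m hm).symm.trans (hy m hm)
  rw [happ hmeas]
  have h := real_couple_cylinder x N
  have hr : ∀ A : Set (Seq 3 × Seq 6), inputs A = ENNReal.ofReal (inputs.real A) :=
    fun A => (ENNReal.ofReal_toReal (measure_ne_top _ _)).symm
  simp only [Set.mem_ofPred_eq]
  rw [hr, hr {p | ∀ m < 2 * N, couple false p.1 p.2 m = x m}, ← ENNReal.ofReal_mul (by norm_num),
    ← ENNReal.ofReal_mul (by norm_num), ← ENNReal.ofReal_add (by positivity) (by positivity), h,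
    ENNReal.ofReal_pow (by norm_num), pow_mul]
  congr 1
  rw [show (1 / 9 : ℝ) = (3 ^ 2)⁻¹ by norm_num, ENNReal.ofReal_inv_of_pos (by norm_num),
    ENNReal.ofReal_pow (by norm_num), ← ENNReal.inv_pow]
  norm_num

/-! ### Primitive recursive predicates -/

section Primrec

variable {α β : Type} [Primcodable α] [Primcodable β]

theorem primrecPred_forall_mem {f : α → List β} (hf : Primrec f) {R : β → α → Prop}
    (hR : PrimrecPred fun p : β × α => R p.1 p.2) : PrimrecPred fun a => ∀ b ∈ f a, R b a :=
  (PrimrecRel.forall_mem_list (PrimrecPred.primrecRel hR)).comp hf .id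

theorem primrecPred_exists_mem {f : α → List β} (hf : Primrec f) {R : β → α → Prop}
    (hR : PrimrecPred fun p : β × α => R p.1 p.2) : PrimrecPred fun a => ∃ b ∈ f a, R b a :=
  (PrimrecRel.exists_mem_list (PrimrecPred.primrecRel hR)).comp hf .id

theorem primrecPred_forall_lt {f : α → ℕ} (hf : Primrec f) {R : ℕ → α → Prop}
    (hR : PrimrecPred fun p : ℕ × α => R p.1 p.2) : PrimrecPred fun a => ∀ b < f a, R b a :=
  (primrecPred_forall_mem (Primrec.list_range.comp hf) hR).of_eq fun a => by simp

theorem primrecPred_exists_lt {f : α → ℕ} (hf : Primrec f) {R : ℕ → α → Prop}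
    (hR : PrimrecPred fun p : ℕ × α => R p.1 p.2) : PrimrecPred fun a => ∃ b < f a, R b a :=
  (primrecPred_exists_mem (Primrec.list_range.comp hf) hR).of_eq fun a => by simp

open Classical in
theorem primrec_length_filter {f : α → List β} (hf : Primrec f) {R : β → α → Prop}
    (hR : PrimrecPred fun p : β × α => R p.1 p.2) :
    Primrec fun a => ((f a).filter fun b => R b a).length :=
  Primrec.list_length.comp ((PrimrecRel.listFilter (PrimrecPred.primrecRel hR)).comp hf .id)

theorem primrec_two_pow : Primrec fun n : ℕ => 2 ^ n :=
  (Primrec.nat_rec₁ (f := fun _ m => 2 * m) 1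
    (Primrec.nat_mul.comp (.const 2) .snd)).of_eq fun n => by
    induction n with
    | zero => rfl
    | succ n ih => simp only [ih]; ring

theorem primrec_six_pow : Primrec fun n : ℕ => 6 ^ n :=
  (Primrec.nat_rec₁ (f := fun _ m => 6 * m) 1
    (Primrec.nat_mul.comp (.const 6) .snd)).of_eq fun n => by
    induction n with
    | zero => rfl
    | succ n ih => simp only [ih]; ring

/-! ### Recursively enumerable predicates -/

theorem rePred_exists {R : α → ℕ → Prop} (hR : PrimrecPred fun p : α × ℕ => R p.1 p.2) :
    REPred fun a => ∃ n, R a n := by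
  classical
  have h : Partrec fun a => Nat.rfind fun n => Part.some (decide (R a n)) :=
    Partrec.rfind (hR.computablePred.decide.partrec)
  refine h.dom_re.of_eq fun a => ?_
  refine Nat.rfind_dom.trans ?_
  simp

theorem exists_eval_of_rePred {W : α → Prop} (hW : REPred W) :
    ∃ c : Nat.Partrec.Code, ∀ a, W a ↔ (c.eval (Encodable.encode a)).Dom := by
  obtain ⟨c, hc⟩ := Nat.Partrec.Code.exists_code.1 hW
  refine ⟨c, fun a => ?_⟩
  rw [hc]
  simp only [Encodable.encodek, Part.coe_some, Part.bind_some, Part.map_Dom]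
  exact ⟨fun h => ⟨h, trivial⟩, fun h => h.1⟩

theorem countable_rePred : {W : α → Prop | REPred W}.Countable := by
  refine (Set.countable_range fun (c : Nat.Partrec.Code) (a : α) =>
    (c.eval (Encodable.encode a)).Dom).mono fun W hW => ?_
  obtain ⟨c, hc⟩ := exists_eval_of_rePred hW
  exact ⟨c, funext fun a => propext (hc a).symm⟩

/-- A recursively enumerable predicate is an increasing union of uniformly primitive recursive
ones. -/
theorem exists_approx_of_rePred {W : α → Prop} (hW : REPred W) :
    ∃ R : ℕ → α → Prop, (PrimrecPred fun p : ℕ × α => R p.1 p.2) ∧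
      (∀ k l a, k ≤ l → R k a → R l a) ∧ ∀ a, W a ↔ ∃ k, R k a := by
  obtain ⟨c, hc⟩ := exists_eval_of_rePred hW
  refine ⟨fun k a => (c.evaln k (Encodable.encode a)).isSome = true, ?_, ?_, ?_⟩
  · refine Primrec.eq.comp (Primrec.option_isSome.comp (Nat.Partrec.Code.primrec_evaln.comp
      (.pair (.pair .fst (.const c)) (Primrec.encode.comp .snd)))) (.const true)
  · intro k l a hkl h
    obtain ⟨x, hx⟩ := Option.isSome_iff_exists.1 h
    exact Option.isSome_iff_exists.2 ⟨x, Nat.Partrec.Code.evaln_mono hkl hx⟩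
  · intro a
    rw [hc, Part.dom_iff_mem]
    simp only [Nat.Partrec.Code.evaln_complete, Option.isSome_iff_exists]
    exact exists_comm

end Primrec

/-! ### Finite strings -/

/-- All strings of length `N` over `k` symbols. -/
def allStrings (k : ℕ) : ℕ → List (List (Fin k))
  | 0 => [[]]
  | N + 1 => (allStrings k N).flatMap fun s => (List.finRange k).map fun a => a :: s

theorem mem_allStrings {k N : ℕ} {l : List (Fin k)} : l ∈ allStrings k N ↔ l.length = N := by
  induction N generalizing l with
  | zero => simp [allStrings]
  | succ N ih => cases l <;> simp [allStrings, ih]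

theorem nodup_allStrings (k N : ℕ) : (allStrings k N).Nodup := by
  induction N with
  | zero => simp [allStrings]
  | succ N ih =>
    rw [allStrings, List.nodup_flatMap]
    refine ⟨fun s _ => (List.nodup_finRange k).map fun a b h => by simpa using h, ?_⟩
    refine ih.imp fun {s t} hst => ?_
    simp only [Function.onFun, List.disjoint_left, List.mem_map, not_exists, not_and]
    rintro _ ⟨a, -, rfl⟩ b - h
    simp at h
    exact hst h.2.symm

theorem primrec_allStrings (k : ℕ) : Primrec (allStrings k) := by
  refine (Primrec.nat_rec₁ (f := fun _ L => L.flatMap fun s => (List.finRange k).map fun a => a :: s)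
    [[]] ?_).of_eq fun N => ?_
  · refine Primrec.list_flatMap .snd (Primrec.list_map (.const _) ?_)
    exact Primrec.list_cons.comp .snd (Primrec.snd.comp .fst)
  · induction N with
    | zero => rfl
    | succ N ih => simp only [allStrings, ← ih]

/-- The sequence that extends a string by zeros. -/
def ofList {n : ℕ} [NeZero n] (l : List (Fin n)) : Seq n := fun i => l.getD i 0

theorem ofList_prefixOf {n : ℕ} [NeZero n] (x : Seq n) {N i : ℕ} (h : i < N) :
    ofList (prefixOf x N) i = x i := getD_prefixOf x h 0

theorem prefixOf_ofList {n : ℕ} [NeZero n] (l : List (Fin n)) : prefixOf (ofList l) l.length = l := by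
  refine List.ext_getElem (by simp) fun i h1 h2 => ?_
  simp [prefixOf, ofList]

theorem take_prefixOf {n : ℕ} (x : Seq n) {m N : ℕ} (h : m ≤ N) :
    (prefixOf x N).take m = prefixOf x m := by
  refine List.ext_getElem (by simp [h]) fun i h1 h2 => ?_
  simp [prefixOf]

theorem prefixOf_eq_map {n : ℕ} (x : Seq n) (N : ℕ) : prefixOf x N = (List.range N).map x := by
  refine List.ext_getElem (by simp) fun i h1 h2 => ?_
  simp [prefixOf]

/-! ### The coupling is primitive recursive -/

theorem getD_map_range {α : Type*} (f : ℕ → α) {m n : ℕ} (h : m < n) (d : α) :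
    ((List.range n).map f).getD m d = f m := by
  simp [List.getD_eq_getElem?_getD, h]

theorem primrec_nodeInTree :
    Primrec₂ fun (l : List (Fin 3)) (n : ℕ) => nodeInTree (ofList l) n := by
  classical
  -- Course-of-values recursion: `L` lists the values at all earlier nodes, so its length is the
  -- current node.
  let par : List Bool → ℕ := fun L => (L.length - 1) / 2
  let sym : List (Fin 3) → List Bool → Fin 3 := fun l L =>
    l.getD ((L.take (par L)).filter fun b => decide (b = true)).length 0
  refine Primrec.nat_strong_rec _ (g := fun l L => some (if L.length = 0 then true else
    L.getD (par L) false &&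
      decide ((sym l L : ℕ) = (L.length - 1) % 2 ∨ sym l L = 2))) ?_ ?_
  · have hlen : Primrec fun p : List (Fin 3) × List Bool => p.2.length :=
      Primrec.list_length.comp .snd
    have hpred : Primrec fun p : List (Fin 3) × List Bool => p.2.length - 1 :=
      Primrec.nat_sub.comp hlen (.const 1)
    have hpar : Primrec fun p : List (Fin 3) × List Bool => par p.2 :=
      Primrec.nat_div.comp hpred (.const 2)
    have htrue : PrimrecPred fun b : Bool => b = true := Primrec.eq.comp .id (.const true)
    have hsym : Primrec fun p : List (Fin 3) × List Bool => sym p.1 p.2 :=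
      (Primrec.list_getD 0).comp .fst (Primrec.list_length.comp ((Primrec.listFilter htrue).comp
        (Primrec.list_take.comp hpar .snd)))
    refine Primrec.option_some.comp (Primrec.ite (Primrec.eq.comp hlen (.const 0)) (.const true)
      (Primrec.and.comp ((Primrec.list_getD false).comp .snd hpar) (PrimrecPred.decide ?_)))
    exact (Primrec.eq.comp (Primrec.fin_val.comp hsym)
      (Primrec.nat_mod.comp hpred (.const 2))).or (Primrec.eq.comp hsym (.const 2))
  · rintro l (_ | n)
    · simp
    · have hpar : par ((List.range (n + 1)).map (nodeInTree (ofList l))) = n / 2 := by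
        simp [par]
      have hsym : sym l ((List.range (n + 1)).map (nodeInTree (ofList l)))
          = ofList l (rank (ofList l) (n / 2)) := by
        simp only [sym, hpar, ofList]
        rw [← List.map_take, List.take_range, min_eq_left (by omega), rank, Nat.count,
          List.countP_eq_length_filter, List.filter_map, List.length_map]
        rfl
      simp only [hpar, hsym]
      rw [getD_map_range _ (by omega), nodeInTree_succ]
      simp

theorem primrec_cut : Primrec₂ fun (p : Bool × List (Fin 3) × List (Fin 6)) (n : ℕ) =>
    cut p.1 (ofList p.2.1) (ofList p.2.2) n := by
  let par : List Bool → Bool := fun L => L.getD ((L.length - 1) / 2) false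
  refine Primrec.nat_strong_rec _ (g := fun p L => some (if L.length = 0 then false else
    par L || decide (emit (p.1 && nodeInTree (ofList p.2.1) L.length) (par L)
      (p.2.2.getD (L.length - 1) 0) = 1))) ?_ ?_
  · have hlen : Primrec fun p : (Bool × List (Fin 3) × List (Fin 6)) × List Bool => p.2.length :=
      Primrec.list_length.comp .snd
    have hpred : Primrec fun p : (Bool × List (Fin 3) × List (Fin 6)) × List Bool =>
        p.2.length - 1 := Primrec.nat_sub.comp hlen (.const 1)
    have hpar : Primrec fun p : (Bool × List (Fin 3) × List (Fin 6)) × List Bool => par p.2 :=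
      (Primrec.list_getD false).comp .snd (Primrec.nat_div.comp hpred (.const 2))
    have hemit : Primrec fun q : Bool × Bool × Fin 6 => emit q.1 q.2.1 q.2.2 := Primrec.dom_finite _
    have htree : Primrec fun p : (Bool × List (Fin 3) × List (Fin 6)) × List Bool =>
        p.1.1 && nodeInTree (ofList p.1.2.1) p.2.length :=
      Primrec.and.comp (Primrec.fst.comp .fst)
        (primrec_nodeInTree.comp (Primrec.fst.comp (Primrec.snd.comp .fst)) hlen)
    have hsym : Primrec fun p : (Bool × List (Fin 3) × List (Fin 6)) × List Bool =>
        p.1.2.2.getD (p.2.length - 1) 0 :=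
      (Primrec.list_getD 0).comp (Primrec.snd.comp (Primrec.snd.comp .fst)) hpred
    refine Primrec.option_some.comp (Primrec.ite (Primrec.eq.comp hlen (.const 0)) (.const false)
      (Primrec.or.comp hpar (PrimrecPred.decide (Primrec.eq.comp
        (hemit.comp (.pair htree (.pair hpar hsym))) (.const 1)))))
  · rintro p (_ | n)
    · simp [cut]
    · have hpar : par ((List.range (n + 1)).map (cut p.1 (ofList p.2.1) (ofList p.2.2)))
          = cut p.1 (ofList p.2.1) (ofList p.2.2) (n / 2) := by
        simp only [par]
        rw [List.length_map, List.length_range, Nat.add_sub_cancel, getD_map_range _ (by omega)]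
      simp only [hpar]
      rw [cut]
      simp [ofList]

theorem primrec_couple : Primrec₂ fun (p : Bool × List (Fin 3) × List (Fin 6)) (n : ℕ) =>
    couple p.1 (ofList p.2.1) (ofList p.2.2) n := by
  have hemit : Primrec fun q : Bool × Bool × Fin 6 => emit q.1 q.2.1 q.2.2 := Primrec.dom_finite _
  refine hemit.comp (.pair (Primrec.and.comp (Primrec.fst.comp .fst) (primrec_nodeInTree.comp
    (Primrec.fst.comp (Primrec.snd.comp .fst)) (Primrec.succ.comp .snd))) (.pair
    (primrec_cut.comp .fst (Primrec.nat_div.comp .snd (.const 2)))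
    ((Primrec.list_getD 0).comp (Primrec.snd.comp (Primrec.snd.comp .fst)) .snd)))

theorem primrec_prefixOf_couple :
    Primrec₂ fun (p : Bool × List (Fin 3) × List (Fin 6)) (N : ℕ) =>
      prefixOf (couple p.1 (ofList p.2.1) (ofList p.2.2)) N := by
  simp only [prefixOf_eq_map]
  exact Primrec.list_map (Primrec.list_range.comp .snd) (primrec_couple.comp (Primrec.fst.comp .fst) .snd)

theorem primrec_chainLength : Primrec fun p : ℕ × ℕ => chainLength p.1 p.2 :=
  Primrec.nat_mul.comp (.const 2) (Primrec.nat_add.comp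
    (Primrec.nat_add.comp .snd (.const 1)) .fst)

theorem primrec_chainPlace :
    Primrec fun p : ℕ × ℕ × ℕ × ℕ => chainPlace p.1 p.2.1 p.2.2.1 p.2.2.2 :=
  Primrec.nat_sub.comp (Primrec.nat_div.comp (Primrec.nat_add.comp (Primrec.nat_mul.comp
    (Primrec.nat_add.comp (Primrec.fst.comp .snd) (.const 1)) (primrec_two_pow.comp .fst))
    (Primrec.fst.comp (Primrec.snd.comp .snd)))
    (primrec_two_pow.comp (Primrec.snd.comp (Primrec.snd.comp .snd)))) (.const 2)

theorem primrecPred_chain {n : ℕ} [NeZero n] (S : Fin n → Bool) : PrimrecPred (chain S) := by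
  have hlen : Primrec fun v : ℕ × ℕ × List (Fin n) => chainLength v.2.1 v.1 :=
    primrec_chainLength.comp (.pair (Primrec.fst.comp .snd) .fst)
  have hp : Primrec fun v : ℕ × ℕ × ℕ × ℕ × List (Fin n) =>
      chainPlace (chainLength v.2.2.2.1 v.2.2.1) v.2.2.1 v.2.1 v.1 := by
    have := primrec_chainPlace.comp (.pair (hlen.comp (Primrec.snd.comp (Primrec.snd (α := ℕ))))
      (.pair (Primrec.fst.comp (Primrec.snd.comp .snd)) (.pair (Primrec.fst.comp .snd) .fst)))
    exact this
  have hl : Primrec fun v : ℕ × ℕ × ℕ × ℕ × List (Fin n) => v.2.2.2.2 :=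
    Primrec.snd.comp (Primrec.snd.comp (Primrec.snd.comp .snd))
  have h1 : PrimrecPred fun v : ℕ × ℕ × ℕ × ℕ × List (Fin n) =>
      chainPlace (chainLength v.2.2.2.1 v.2.2.1) v.2.2.1 v.2.1 v.1 < v.2.2.2.2.length ∧
      S (v.2.2.2.2.getD (chainPlace (chainLength v.2.2.2.1 v.2.2.1) v.2.2.1 v.2.1 v.1) 0) = true :=
    (Primrec.nat_lt.comp hp (Primrec.list_length.comp hl)).and
      (Primrec.eq.comp ((Primrec.dom_finite S).comp ((Primrec.list_getD 0).comp hl hp))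
        (.const true))
  have h2 := primrecPred_forall_lt (f := fun v : ℕ × ℕ × ℕ × List (Fin n) =>
    chainLength v.2.2.1 v.2.1) (R := fun j v =>
      chainPlace (chainLength v.2.2.1 v.2.1) v.2.1 v.1 j < v.2.2.2.length ∧
      S (v.2.2.2.getD (chainPlace (chainLength v.2.2.1 v.2.1) v.2.1 v.1 j) 0) = true)
    (hlen.comp .snd) h1
  have h3 := primrecPred_exists_lt (f := fun v : ℕ × ℕ × List (Fin n) => 2 ^ chainLength v.2.1 v.1)
    (R := fun t v => ∀ j < chainLength v.2.1 v.1,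
      chainPlace (chainLength v.2.1 v.1) v.1 t j < v.2.2.length ∧
      S (v.2.2.getD (chainPlace (chainLength v.2.1 v.1) v.1 t j) 0) = true)
    (primrec_two_pow.comp hlen) h2
  exact primrecPred_exists_lt (f := fun p : ℕ × List (Fin n) => p.2.length)
    (R := fun q p => ∃ t < 2 ^ chainLength p.1 q, ∀ j < chainLength p.1 q,
      chainPlace (chainLength p.1 q) q t j < p.2.length ∧
      S (p.2.getD (chainPlace (chainLength p.1 q) q t j) 0) = true)
    (Primrec.list_length.comp .snd) h3

theorem rePred_chain {n : ℕ} [NeZero n] (S : Fin n → Bool) : REPred (chain S) :=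
  (primrecPred_chain S).computablePred.to_re

/-! ### Random sequences have no tails in a small set of labels -/

theorem isMLTest_chain {n : ℕ} [NeZero n] {S : Fin n → Bool}
    (hS : 3 * (Finset.univ.filter fun a => S a = true).card ≤ n) :
    IsMLTest (lebesgue n) (chain S) :=
  ⟨rePred_chain S, lebesgue_chain_le hS⟩

theorem not_hasTail_of_mem_MLR {x : Seq 3} (hx : x ∈ MLR (lebesgue 3)) :
    ¬ HasTail (fun a => decide (a = 2)) x := fun h =>
  hx _ (isMLTest_chain (S := fun a : Fin 3 => decide (a = 2)) (by decide))
    (Set.mem_iInter.2 (mem_chain_of_hasTail h))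

theorem measure_eq_zero_of_le_pow {Ω : Type*} [MeasurableSpace Ω] {μ : Measure Ω} {A : Set Ω}
    (h : ∀ i : ℕ, μ A ≤ (2 : ℝ≥0∞)⁻¹ ^ i) : μ A = 0 :=
  le_antisymm (ge_of_tendsto'
    (ENNReal.tendsto_pow_atTop_nhds_zero_of_lt_one ENNReal.one_half_lt_one) h) bot_le

theorem ae_not_hasTail : ∀ᵐ r ∂lebesgue 6, ¬ HasTail (fun a => decide (4 ≤ a)) r := by
  rw [ae_iff]
  refine measure_eq_zero_of_le_pow fun i => ?_
  refine (measure_mono fun r hr => ?_).trans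
    (lebesgue_chain_le (S := fun a : Fin 6 => decide (4 ≤ a)) (by decide) i)
  exact mem_chain_of_hasTail (not_not.1 hr) i

/-! ### Pulling back a test along the coupling -/

/-- The labelings all of whose preimages under `couple` are covered by a given test, or by the test
`chain`. -/
def pullback (R : ℕ → ℕ × List (Fin 3) → Prop) (p : ℕ × List (Fin 3)) : Prop :=
  ∀ c ∈ [true, false], ∀ ζ ∈ allStrings 3 p.2.length, ∀ ρ ∈ allStrings 6 p.2.length,
    prefixOf (couple c (ofList ζ) (ofList ρ)) p.2.length = p.2 →
      (c = true ∧ ∃ m < p.2.length + 1, R p.2.length (p.1 + 1, ζ.take m)) ∨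
        chain (fun a : Fin 6 => decide (4 ≤ a)) (p.1 + 1, ρ)

/-- All quantifiers in `pullback` range over finite lists computed from the string, so the condition
is decided stage by stage. -/
theorem primrecPred_pullback {R : ℕ → ℕ × List (Fin 3) → Prop}
    (hR : PrimrecPred fun p : ℕ × ℕ × List (Fin 3) => R p.1 p.2) : PrimrecPred (pullback R) := by
  have hlen : Primrec fun p : ℕ × List (Fin 3) => p.2.length := Primrec.list_length.comp .snd
  have hsucc : Primrec fun p : ℕ × List (Fin 3) => p.1 + 1 := Primrec.succ.comp .fst
  have hex : PrimrecPred fun v : List (Fin 3) × ℕ × List (Fin 3) =>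
      ∃ m < v.2.2.length + 1, R v.2.2.length (v.2.1 + 1, v.1.take m) := by
    refine primrecPred_exists_lt (f := fun v : List (Fin 3) × ℕ × List (Fin 3) => v.2.2.length + 1)
      (R := fun m v => R v.2.2.length (v.2.1 + 1, v.1.take m))
      (Primrec.succ.comp (hlen.comp .snd)) ?_
    have := hR.comp (.pair (hlen.comp (Primrec.snd.comp .snd)) (.pair
      (hsucc.comp (Primrec.snd.comp .snd)) (Primrec.list_take.comp .fst
        (Primrec.fst.comp (Primrec.snd (α := ℕ))))))
    exact this
  have hbody : PrimrecPred fun v : List (Fin 6) × List (Fin 3) × Bool × ℕ × List (Fin 3) =>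
      prefixOf (couple v.2.2.1 (ofList v.2.1) (ofList v.1)) v.2.2.2.2.length = v.2.2.2.2 →
      (v.2.2.1 = true ∧ ∃ m < v.2.2.2.2.length + 1,
        R v.2.2.2.2.length (v.2.2.2.1 + 1, v.2.1.take m)) ∨
        chain (fun a : Fin 6 => decide (4 ≤ a)) (v.2.2.2.1 + 1, v.1) := by
    have hp : Primrec fun v : List (Fin 6) × List (Fin 3) × Bool × ℕ × List (Fin 3) => v.2.2.2 :=
      Primrec.snd.comp (Primrec.snd.comp .snd)
    have hc : Primrec fun v : List (Fin 6) × List (Fin 3) × Bool × ℕ × List (Fin 3) => v.2.2.1 :=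
      Primrec.fst.comp (Primrec.snd.comp .snd)
    have hζ : Primrec fun v : List (Fin 6) × List (Fin 3) × Bool × ℕ × List (Fin 3) => v.2.1 :=
      Primrec.fst.comp .snd
    have h1 := Primrec.eq.comp (primrec_prefixOf_couple.comp (.pair hc (.pair hζ .fst))
      (hlen.comp hp)) (Primrec.snd.comp hp)
    have h2 := hex.comp (.pair hζ hp)
    have h3 := (primrecPred_chain fun a : Fin 6 => decide (4 ≤ a)).comp (.pair (hsucc.comp hp)
      (Primrec.fst (β := List (Fin 3) × Bool × ℕ × List (Fin 3))))
    have h4 := h1.not.or (((Primrec.eq.comp hc (.const true)).and h2).or h3)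
    exact h4.of_eq fun v => imp_iff_not_or.symm
  have hρ := primrecPred_forall_mem (α := List (Fin 3) × Bool × ℕ × List (Fin 3))
    (R := fun ρ v => prefixOf (couple v.2.1 (ofList v.1) (ofList ρ)) v.2.2.2.length = v.2.2.2 →
      (v.2.1 = true ∧ ∃ m < v.2.2.2.length + 1, R v.2.2.2.length (v.2.2.1 + 1, v.1.take m)) ∨
        chain (fun a : Fin 6 => decide (4 ≤ a)) (v.2.2.1 + 1, ρ))
    ((primrec_allStrings 6).comp (hlen.comp (Primrec.snd.comp .snd))) hbody
  have hζ := primrecPred_forall_mem (α := Bool × ℕ × List (Fin 3))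
    (R := fun ζ v => ∀ ρ ∈ allStrings 6 v.2.2.length,
      prefixOf (couple v.1 (ofList ζ) (ofList ρ)) v.2.2.length = v.2.2 →
      (v.1 = true ∧ ∃ m < v.2.2.length + 1, R v.2.2.length (v.2.1 + 1, ζ.take m)) ∨
        chain (fun a : Fin 6 => decide (4 ≤ a)) (v.2.1 + 1, ρ))
    ((primrec_allStrings 3).comp (hlen.comp .snd)) hρ
  exact primrecPred_forall_mem (α := ℕ × List (Fin 3))
    (R := fun c p => ∀ ζ ∈ allStrings 3 p.2.length, ∀ ρ ∈ allStrings 6 p.2.length,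
      prefixOf (couple c (ofList ζ) (ofList ρ)) p.2.length = p.2 →
      (c = true ∧ ∃ m < p.2.length + 1, R p.2.length (p.1 + 1, ζ.take m)) ∨
        chain (fun a : Fin 6 => decide (4 ≤ a)) (p.1 + 1, ρ)) (.const [true, false]) hζ

theorem mem_of_mem_pullback {R : ℕ → ℕ × List (Fin 3) → Prop} {i : ℕ} {c : Bool} {z : Seq 3}
    {r : Seq 6} (h : couple c z r ∈ openFamily (pullback R) i) :
    (c = true ∧ z ∈ openFamily (fun p => ∃ k, R k p) (i + 1)) ∨
      r ∈ openFamily (chain fun a => decide (4 ≤ a)) (i + 1) := by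
  obtain ⟨N, hN⟩ := mem_openFamily.1 h
  have := hN c (by cases c <;> simp) (prefixOf z N) (by simp [mem_allStrings]) (prefixOf r N)
    (by simp [mem_allStrings]) (by
      rw [length_prefixOf, prefixOf_eq_iff]
      exact couple_congr_of_lt (fun i hi => ofList_prefixOf z hi) fun i hi => ofList_prefixOf r hi)
  rw [length_prefixOf] at this
  refine this.imp (fun ⟨hc, m, hm, h⟩ => ⟨hc, ?_⟩) fun h => mem_openFamily.2 ⟨N, h⟩
  rw [take_prefixOf z (by omega)] at h
  exact mem_openFamily.2 ⟨m, N, h⟩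

theorem chain_prefixOf_mono {n : ℕ} [NeZero n] {S : Fin n → Bool} {i M N : ℕ} {x : Seq n}
    (hMN : M ≤ N) (h : chain S (i, prefixOf x M)) : chain S (i, prefixOf x N) := by
  obtain ⟨q, hq, t, ht, h⟩ := h
  simp only [length_prefixOf] at hq h
  refine ⟨q, by simpa using hq.trans_le hMN, t, ht, fun j hj => ?_⟩
  obtain ⟨h1, h2⟩ := h j hj
  rw [getD_prefixOf x h1] at h2
  simp only [length_prefixOf]
  exact ⟨h1.trans_le hMN, by rw [getD_prefixOf x (h1.trans_le hMN)]; exact h2⟩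

theorem isClosed_of_agree_prod {m n N : ℕ} {A : Set (Bool × Seq m × Seq n)}
    (hA : ∀ c z z' r r', (∀ i < N, z i = z' i) → (∀ i < N, r i = r' i) →
      (c, z, r) ∈ A → (c, z', r') ∈ A) : IsClosed A := by
  let f : Bool × Seq m × Seq n → Bool × (Fin N → Fin m) × (Fin N → Fin n) :=
    fun p => (p.1, firstPlaces N p.2.1, firstPlaces N p.2.2)
  have hc {k : ℕ} : Continuous (firstPlaces (n := k) N) := continuous_pi fun _ => continuous_apply _
  have hf : Continuous f := continuous_fst.prodMk ((hc.comp (continuous_fst.comp continuous_snd)).prodMk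
    (hc.comp (continuous_snd.comp continuous_snd)))
  have : A = f ⁻¹' (f '' A) := by
    refine Set.Subset.antisymm (Set.subset_preimage_image _ _) ?_
    rintro ⟨c, z, r⟩ ⟨⟨c', z', r'⟩, hp, hpq⟩
    simp only [f, Prod.mk.injEq] at hpq
    obtain ⟨rfl, h1, h2⟩ := hpq
    exact hA _ _ _ _ _ (fun i hi => congrFun h1 ⟨i, hi⟩) (fun i hi => congrFun h2 ⟨i, hi⟩) hp
  rw [this]
  exact (isClosed_discrete _).preimage hf

/-- Compactness: if no prefix of `x` enters `pullback R`, the finite counterexamples form decreasing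
nonempty closed sets. A common point is a preimage of `x` under `couple` that avoids both tests,
against `hx`. -/
theorem mem_pullback {R : ℕ → ℕ × List (Fin 3) → Prop}
    (hmono : ∀ k l a, k ≤ l → R k a → R l a) {i : ℕ} {x : Seq 3}
    (hx : ∀ c z r, couple c z r = x →
      (c = true ∧ z ∈ openFamily (fun p => ∃ k, R k p) (i + 1)) ∨
        r ∈ openFamily (chain fun a => decide (4 ≤ a)) (i + 1)) :
    x ∈ openFamily (pullback R) i := by
  by_contra hcon
  rw [mem_openFamily, not_exists] at hcon
  let K : ℕ → Set (Bool × Seq 3 × Seq 6) := fun N => {p |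
    (∀ m < N, couple p.1 p.2.1 p.2.2 m = x m) ∧
    ¬ (p.1 = true ∧ ∃ m < N + 1, R N (i + 1, prefixOf p.2.1 m)) ∧
    ¬ chain (fun a : Fin 6 => decide (4 ≤ a)) (i + 1, prefixOf p.2.2 N)}
  have hanti (N : ℕ) : K (N + 1) ⊆ K N := by
    rintro p ⟨h1, h2, h3⟩
    refine ⟨fun m hm => h1 m (by omega), fun ⟨hc, m, hm, h⟩ => h2 ⟨hc, m, by omega, ?_⟩,
      fun h => h3 (chain_prefixOf_mono (by omega) h)⟩
    exact hmono _ _ _ (by omega) h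
  have hne (N : ℕ) : (K N).Nonempty := by
    have h := hcon N
    simp only [pullback, length_prefixOf, not_forall] at h
    obtain ⟨c, -, ζ, hζ, ρ, hρ, he, h⟩ := h
    rw [mem_allStrings] at hζ hρ
    rw [not_or] at h
    refine ⟨(c, ofList ζ, ofList ρ), prefixOf_eq_iff.1 he, fun ⟨hc, m, hm, hm'⟩ => ?_, ?_⟩
    · refine h.1 ⟨hc, m, hm, ?_⟩
      have e : ζ.take m = prefixOf (ofList ζ) m := by
        rw [← take_prefixOf (ofList ζ) (show m ≤ N by omega), ← hζ, prefixOf_ofList]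
      rw [e]; exact hm'
    · have e : prefixOf (ofList ρ) N = ρ := by rw [← hρ, prefixOf_ofList]
      simp only [e]; exact h.2
  have hclosed (N : ℕ) : IsClosed (K N) := by
    refine isClosed_of_agree_prod (N := N) ?_
    rintro c z z' r r' hz hr ⟨h1, h2, h3⟩
    refine ⟨fun m hm => ?_, fun ⟨hc, m, hm, h⟩ => h2 ⟨hc, m, hm, ?_⟩, ?_⟩
    · rw [← h1 m hm]; exact (couple_congr_of_lt hz hr m hm).symm
    · have e : prefixOf z m = prefixOf z' m := prefixOf_eq_iff.2 fun i hi => hz i (by omega)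
      simp only [e]; exact h
    · simp only [← prefixOf_eq_iff.2 hr]; exact h3
  obtain ⟨⟨c, z, r⟩, hp⟩ := IsCompact.nonempty_iInter_of_sequence_nonempty_isCompact_isClosed K
    hanti hne (hclosed 0).isCompact hclosed
  rw [Set.mem_iInter] at hp
  rcases hx c z r (funext fun m => (hp (m + 1)).1 m (by omega)) with ⟨hc, hz⟩ | hr
  · obtain ⟨m, k, h⟩ := mem_openFamily.1 hz
    refine (hp (m + k)).2.1 ⟨hc, m, by omega, hmono _ _ _ (by omega) h⟩
  · obtain ⟨m, h⟩ := mem_openFamily.1 hr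
    exact (hp m).2.2 h

/-- For either value of `c`, the preimage of level `i` under `couple` lies in the union of two
events of measure at most `2⁻¹ ^ (i + 1)`. The law of the coupling averages the two values of `c`.
-/
theorem isMLTest_pullback {R : ℕ → ℕ × List (Fin 3) → Prop}
    (hR : PrimrecPred fun p : ℕ × ℕ × List (Fin 3) => R p.1 p.2)
    (hm : ∀ i, lebesgue 3 (openFamily (fun p => ∃ k, R k p) i) ≤ (2 : ℝ≥0∞)⁻¹ ^ i) :
    IsMLTest (lebesgue 3) (pullback R) := by
  refine ⟨(primrecPred_pullback hR).computablePred.to_re, fun i => ?_⟩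
  set B : Set (Seq 3 × Seq 6) :=
    openFamily (fun p => ∃ k, R k p) (i + 1) ×ˢ Set.univ ∪
      Set.univ ×ˢ openFamily (chain fun a => decide (4 ≤ a)) (i + 1) with hB
  have hle : inputs B ≤ 2⁻¹ ^ i := by
    refine (measure_union_le _ _).trans ?_
    rw [Measure.prod_prod, Measure.prod_prod, measure_univ, measure_univ, mul_one, one_mul]
    refine le_trans ?_ (le_of_eq (show (2 : ℝ≥0∞)⁻¹ ^ (i + 1) + 2⁻¹ ^ (i + 1) = 2⁻¹ ^ i from ?_))
    · exact add_le_add (hm (i + 1)) (lebesgue_chain_le (by decide) (i + 1))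
    rw [pow_succ, ← mul_add, ENNReal.inv_two_add_inv_two, mul_one]
  have hsub (c : Bool) : inputs {p | couple c p.1 p.2 ∈ openFamily (pullback R) i} ≤ 2⁻¹ ^ i := by
    refine (measure_mono fun p hp => ?_).trans hle
    rcases mem_of_mem_pullback hp with ⟨-, h⟩ | h
    · exact .inl ⟨h, trivial⟩
    · exact .inr ⟨trivial, h⟩
  rw [lebesgue_eq_couple (measurableSet_openFamily _ _)]
  calc _ ≤ ENNReal.ofReal (3 / 4) * 2⁻¹ ^ i + ENNReal.ofReal (1 / 4) * 2⁻¹ ^ i := by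
        gcongr <;> exact hsub _
    _ = 2⁻¹ ^ i := by
        rw [← add_mul, ← ENNReal.ofReal_add (by norm_num) (by norm_num)]
        norm_num

/-- The tree of extendible nodes of a random labeling is coded by a random sequence. -/
theorem exists_random_code {x : Seq 3} (hx : x ∈ MLR (lebesgue 3)) (hne : (survivors x).Nonempty) :
    ∃ z ∈ MLR (lebesgue 3), survivors x = paths (codedTree z) := by
  obtain ⟨z, hz, huniq⟩ := exists_code_survivors hne
  refine ⟨z, fun W hW hzW => ?_, hz⟩
  obtain ⟨R, hR, hmono, hWR⟩ := exists_approx_of_rePred hW.1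
  obtain rfl : W = fun p => ∃ k, R k p := funext fun p => propext (hWR p)
  refine hx _ (isMLTest_pullback hR hW.2) (Set.mem_iInter.2 fun i => ?_)
  refine mem_pullback hmono fun c z' r hc => ?_
  -- Either `r` is exceptional and lies in `chain`, or `x` determines the preimage, which then has
  -- `c = true` and `z' = z`.
  by_cases hr : HasTail (fun a => decide (4 ≤ a)) r
  · exact .inr (mem_chain_of_hasTail hr _)
  · obtain ⟨h1, rfl⟩ := huniq c z' r hc hr
    exact .inl ⟨h1, Set.mem_iInter.1 hzW _⟩

/-! ### Pushing a test forward along the coupling -/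

open Classical in
/-- The trees for which the labeling `couple` is covered by a given test with large
probability. -/
def heavy (R : ℕ → ℕ × List (Fin 3) → Prop) (p : ℕ × List (Fin 3)) : Prop :=
  6 ^ p.2.length < 2 ^ p.1 * ((allStrings 6 p.2.length).filter fun ρ => ∃ m < p.2.length + 1,
    R p.2.length (2 * p.1 + 1, prefixOf (couple true (ofList p.2) (ofList ρ)) m)).length

theorem primrecPred_heavy {R : ℕ → ℕ × List (Fin 3) → Prop}
    (hR : PrimrecPred fun p : ℕ × ℕ × List (Fin 3) => R p.1 p.2) : PrimrecPred (heavy R) := by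
  have hlen : Primrec fun p : ℕ × List (Fin 3) => p.2.length := Primrec.list_length.comp .snd
  have hlevel : Primrec fun p : ℕ × List (Fin 3) => 2 * p.1 + 1 :=
    Primrec.succ.comp (Primrec.nat_mul.comp (.const 2) .fst)
  have hex : PrimrecPred fun v : List (Fin 6) × ℕ × List (Fin 3) => ∃ m < v.2.2.length + 1,
      R v.2.2.length (2 * v.2.1 + 1, prefixOf (couple true (ofList v.2.2) (ofList v.1)) m) := by
    refine primrecPred_exists_lt (f := fun v : List (Fin 6) × ℕ × List (Fin 3) => v.2.2.length + 1)
      (R := fun m v => R v.2.2.length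
        (2 * v.2.1 + 1, prefixOf (couple true (ofList v.2.2) (ofList v.1)) m))
      (Primrec.succ.comp (hlen.comp .snd)) ?_
    have hp : Primrec fun v : ℕ × List (Fin 6) × ℕ × List (Fin 3) => v.2.2 :=
      Primrec.snd.comp .snd
    have := hR.comp (.pair (hlen.comp hp) (.pair (hlevel.comp hp) (primrec_prefixOf_couple.comp
      (.pair (.const true) (.pair (Primrec.snd.comp hp) (Primrec.fst.comp .snd))) .fst)))
    exact this
  have hcount := primrec_length_filter (α := ℕ × List (Fin 3))
    (R := fun ρ p => ∃ m < p.2.length + 1,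
      R p.2.length (2 * p.1 + 1, prefixOf (couple true (ofList p.2) (ofList ρ)) m))
    ((primrec_allStrings 6).comp hlen) hex
  have := Primrec.nat_lt.comp (primrec_six_pow.comp hlen)
    (Primrec.nat_mul.comp (primrec_two_pow.comp .fst) hcount)
  exact this.of_eq fun p => by unfold heavy; congr!

theorem lebesgue_prefixOf {n : ℕ} [NeZero n] (N : ℕ) (P : List (Fin n) → Prop)
    [DecidablePred P] :
    lebesgue n {x | P (prefixOf x N)}
      = ((allStrings n N).filter fun l => P l).length * (n : ℝ≥0∞)⁻¹ ^ N := by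
  have hset : {x : Seq n | P (prefixOf x N)} = firstPlaces N ⁻¹'
      ((Finset.univ.filter fun f : Fin N → Fin n => P (List.ofFn f) : Finset _) : Set _) := by
    ext x; simp [prefixOf]; rfl
  rw [hset, lebesgue_firstPlaces]
  congr 2
  rw [← List.toFinset_card_of_nodup ((nodup_allStrings n N).filter _),
    ← Finset.card_image_of_injective _ (List.ofFn_injective (n := N) (α := Fin n))]
  congr 1
  ext l
  simp only [Finset.mem_image, Finset.mem_filter, Finset.mem_univ, true_and, List.mem_toFinset,
    List.mem_filter, mem_allStrings, decide_eq_true_eq]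
  constructor
  · rintro ⟨f, hf, rfl⟩; exact ⟨by simp, hf⟩
  · rintro ⟨rfl, hl⟩; exact ⟨l.get, by simpa using hl, by simp⟩

/-- The first `N` labels depend on only `N` symbols of each input, so the fibre measure is a count
divided by `6 ^ N`. -/
theorem heavy_prefixOf {R : ℕ → ℕ × List (Fin 3) → Prop} {i N : ℕ} {z : Seq 3} :
    heavy R (i, prefixOf z N) ↔ (2 : ℝ≥0∞)⁻¹ ^ i < lebesgue 6
      {r | ∃ m < N + 1, R N (2 * i + 1, prefixOf (couple true z r) m)} := by
  classical
  have hset : {r | ∃ m < N + 1, R N (2 * i + 1, prefixOf (couple true z r) m)} =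
      {r | ∃ m < N + 1, R N (2 * i + 1,
        prefixOf (couple true (ofList (prefixOf z N)) (ofList (prefixOf r N))) m)} := by
    ext r
    refine exists_congr fun m => and_congr_right fun hm => ?_
    have : prefixOf (couple true (ofList (prefixOf z N)) (ofList (prefixOf r N))) m
        = prefixOf (couple true z r) m := prefixOf_eq_iff.2 fun j hj =>
      couple_congr_of_lt (n := N) (fun i hi => ofList_prefixOf z hi)
        (fun i hi => ofList_prefixOf r hi) j (by omega)
    rw [this]
  rw [hset, lebesgue_prefixOf N fun ρ => ∃ m < N + 1, R N (2 * i + 1,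
        prefixOf (couple true (ofList (prefixOf z N)) (ofList ρ)) m)]
  simp only [heavy, length_prefixOf]
  generalize (List.filter _ _).length = q
  rw [← ENNReal.inv_pow, ← ENNReal.inv_pow, ← div_eq_mul_inv,
    ENNReal.lt_div_iff_mul_lt (by simp) (by simp), mul_comm _⁻¹, ← div_eq_mul_inv,
    ENNReal.div_lt_iff (by simp) (by simp), mul_comm _ q]
  exact_mod_cast Iff.rfl

/-- The fibre is an increasing union of its finite approximations. Being strict, the inequality
already holds at a finite stage, which makes the condition enumerable. -/
theorem mem_heavy {R : ℕ → ℕ × List (Fin 3) → Prop} (hmono : ∀ k l a, k ≤ l → R k a → R l a)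
    {i : ℕ} {z : Seq 3} : z ∈ openFamily (heavy R) i ↔ (2 : ℝ≥0∞)⁻¹ ^ i < lebesgue 6
      {r | couple true z r ∈ openFamily (fun p => ∃ k, R k p) (2 * i + 1)} := by
  have hU : {r | couple true z r ∈ openFamily (fun p => ∃ k, R k p) (2 * i + 1)} =
      ⋃ N, {r | ∃ m < N + 1, R N (2 * i + 1, prefixOf (couple true z r) m)} := by
    ext r
    simp only [Set.mem_iUnion, Set.mem_ofPred_eq, mem_openFamily]
    constructor
    · rintro ⟨m, k, h⟩
      exact ⟨m + k, m, by omega, hmono _ _ _ (by omega) h⟩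
    · rintro ⟨N, m, -, h⟩
      exact ⟨m, N, h⟩
  have hm : Monotone fun N => {r | ∃ m < N + 1, R N (2 * i + 1, prefixOf (couple true z r) m)} := by
    rintro M N hMN r ⟨m, hm, h⟩
    exact ⟨m, by omega, hmono _ _ _ hMN h⟩
  rw [mem_openFamily, hU, hm.measure_iUnion, lt_iSup_iff]
  simp only [heavy_prefixOf]

/-- Markov's inequality for the fibre measure. Level `2 * i + 1` leaves a spare factor `2⁻¹ ≤ 3 / 4`
to divide out the weight of `c = true`, so `inputs B` is at most `2⁻¹ ^ i * 2⁻¹ ^ i`. -/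
theorem lebesgue_heavy_le {R : ℕ → ℕ × List (Fin 3) → Prop}
    (hmono : ∀ k l a, k ≤ l → R k a → R l a)
    (hm : ∀ i, lebesgue 3 (openFamily (fun p => ∃ k, R k p) i) ≤ (2 : ℝ≥0∞)⁻¹ ^ i) (i : ℕ) :
    lebesgue 3 (openFamily (heavy R) i) ≤ 2⁻¹ ^ i := by
  set U := openFamily (fun p => ∃ k, R k p) (2 * i + 1)
  set B : Set (Seq 3 × Seq 6) := {p | couple true p.1 p.2 ∈ U}
  have hB : MeasurableSet B := measurable_couple true (measurableSet_openFamily _ _)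
  have hinputs : inputs B ≤ 2⁻¹ ^ i * 2⁻¹ ^ i := by
    have h1 : ENNReal.ofReal (3 / 4) * inputs B ≤ 2⁻¹ ^ (2 * i + 1) := by
      refine le_trans ?_ (hm (2 * i + 1))
      rw [lebesgue_eq_couple (measurableSet_openFamily _ _)]
      exact le_self_add
    have h2 : (2⁻¹ : ℝ≥0∞) ≤ ENNReal.ofReal (3 / 4) := by
      rw [show (2⁻¹ : ℝ≥0∞) = ENNReal.ofReal 2⁻¹ by
        rw [ENNReal.ofReal_inv_of_pos (by norm_num)]; simp]
      exact ENNReal.ofReal_le_ofReal (by norm_num)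
    have h3 : 2⁻¹ * inputs B ≤ 2⁻¹ * (2⁻¹ ^ i * 2⁻¹ ^ i) := by
      refine (mul_le_mul_left h2 _).trans (h1.trans_eq ?_)
      rw [pow_succ, two_mul, pow_add, mul_comm]
    exact (ENNReal.mul_le_mul_iff_right (by simp) (by simp)).1 h3
  have hmarkov := mul_meas_ge_le_lintegral (μ := lebesgue 3)
    (measurable_measure_prodMk_left (ν := lebesgue 6) hB) (2⁻¹ ^ i)
  rw [← Measure.prod_apply hB] at hmarkov
  have h4 : 2⁻¹ ^ i * lebesgue 3 (openFamily (heavy R) i) ≤ 2⁻¹ ^ i * 2⁻¹ ^ i := by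
    refine le_trans ?_ (hmarkov.trans hinputs)
    gcongr
    intro z hz
    exact ((mem_heavy hmono).1 hz).le
  exact (ENNReal.mul_le_mul_iff_right (by simp) (by simp)).1 h4

/-- The labelings obtained from a random tree almost surely pass a given test. -/
theorem ae_couple_notMem {z : Seq 3} (hz : z ∈ MLR (lebesgue 3)) {W : ℕ × List (Fin 3) → Prop}
    (hW : IsMLTest (lebesgue 3) W) :
    ∀ᵐ r ∂lebesgue 6, couple true z r ∉ ⋂ i, openFamily W i := by
  obtain ⟨R, hR, hmono, hWR⟩ := exists_approx_of_rePred hW.1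
  obtain rfl : W = fun p => ∃ k, R k p := funext fun p => propext (hWR p)
  -- Uniting all later levels turns "`z` is in only finitely many heavy sets" into avoidance of a
  -- single Martin-Löf test. The shift by one makes the geometric sum `2⁻¹ ^ j`.
  have hV : IsMLTest (lebesgue 3) fun p => ∃ k, heavy R (p.1 + 1 + k, p.2) := by
    refine ⟨rePred_exists ?_, fun j => ?_⟩
    · have := (primrecPred_heavy hR).comp (.pair (Primrec.nat_add.comp (Primrec.succ.comp
        (Primrec.fst.comp .fst)) .snd) (Primrec.snd.comp (Primrec.fst (β := ℕ))))
      exact this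
    · have hU : openFamily (fun p => ∃ k, heavy R (p.1 + 1 + k, p.2)) j
          ⊆ ⋃ k, openFamily (heavy R) (j + 1 + k) := by
        rintro x ⟨σ, ⟨k, hk⟩, hx⟩
        exact Set.mem_iUnion.2 ⟨k, σ, hk, hx⟩
      refine (measure_mono hU).trans ((measure_iUnion_le _).trans
        ((ENNReal.tsum_le_tsum fun k => lebesgue_heavy_le hmono hW.2 (j + 1 + k)).trans_eq ?_))
      simp only [pow_add _ (j + 1), ENNReal.tsum_mul_left, ENNReal.tsum_geometric_two]
      rw [pow_succ, mul_assoc, ENNReal.inv_mul_cancel (by norm_num) (by norm_num), mul_one]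
  have hz' := hz _ hV
  rw [Set.mem_iInter, not_forall] at hz'
  obtain ⟨j, hj⟩ := hz'
  rw [ae_iff]
  refine measure_eq_zero_of_le_pow fun i => ?_
  -- From level `j + 1` on, `z` is never heavy, so the fibre measures tend to zero and the bad fibre
  -- is null.
  have hi : z ∉ openFamily (heavy R) (j + 1 + i) := fun ⟨σ, h, hσ⟩ => hj ⟨σ, ⟨i, h⟩, hσ⟩
  rw [mem_heavy hmono, not_lt] at hi
  refine (measure_mono fun r hr => ?_).trans (hi.trans
    (pow_le_pow_right_of_le_one' (by simp) (by omega)))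
  exact Set.mem_iInter.1 (not_not.1 hr) _

/-- Every random tree is the tree of extendible nodes of a random labeling. -/
theorem exists_random_labeling {z : Seq 3} (hz : z ∈ MLR (lebesgue 3)) :
    ∃ x ∈ MLR (lebesgue 3), survivors x = paths (codedTree z) := by
  have hall : ∀ᵐ r ∂lebesgue 6, ∀ W ∈ {W : ℕ × List (Fin 3) → Prop | REPred W},
      IsMLTest (lebesgue 3) W → couple true z r ∉ ⋂ i, openFamily W i := by
    rw [ae_ball_iff countable_rePred]
    intro W _
    by_cases hW : IsMLTest (lebesgue 3) W
    · exact (ae_couple_notMem hz hW).mono fun _ h _ => h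
    · exact Filter.Eventually.of_forall fun _ h => absurd h hW
  obtain ⟨r, h1, h2⟩ := (hall.and ae_not_hasTail).exists
  exact ⟨couple true z r, fun W hW => h1 W hW.1 hW, survivors_couple_true h2⟩

end RandomZeros

theorem mainTheorem1 :
    (∀ F : RandomZeros.Seq 2 →. RandomZeros.Seq 2, RandomZeros.IsRandomContinuous F →
      (RandomZeros.zeroSet F).Nonempty →
        RandomZeros.IsRandomClosedSet (RandomZeros.zeroSet F)) ∧
    (∀ C : Set (RandomZeros.Seq 2), RandomZeros.IsRandomClosedSet C →
      ∃ F : RandomZeros.Seq 2 →. RandomZeros.Seq 2, RandomZeros.IsRandomContinuous F ∧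
        C = RandomZeros.zeroSet F) := by
  refine ⟨?_, ?_⟩
  · rintro _ ⟨-, x, hx, rfl⟩ hne
    rw [RandomZeros.zeroSet_codedFun (RandomZeros.not_hasTail_of_mem_MLR hx)] at hne ⊢
    obtain ⟨z, hz, h⟩ := RandomZeros.exists_random_code hx hne
    exact ⟨hne, h ▸ RandomZeros.isClosed_paths _, z, hz, h⟩
  · rintro _ ⟨-, -, z, hz, rfl⟩
    obtain ⟨x, hx, h⟩ := RandomZeros.exists_random_labeling hz
    refine ⟨RandomZeros.codedFun x, ⟨RandomZeros.isContinuousPartial_codedFun x, x, hx, rfl⟩, ?_⟩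
    rw [RandomZeros.zeroSet_codedFun (RandomZeros.not_hasTail_of_mem_MLR hx), h]
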